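/- **Setting.** Let $\Omega\subset\mathbb R^3$ be a bounded Lipschitz domain (open, connected, nonempty, Lipschitz boundary) and $B\subset\Omega$ a Lipschitz domain. Let $\boldsymbol E_d\in C^1(B;\mathbb R^3)$ and $\kappa\in C^1(B)$ with $\kappa>0$, where $C^1(B)$ is the Banach space of continuously differentiable functions on $B$ that are bounded together with their first derivatives. Let $j_c>0$, let $\boldsymbol f\in L^2(\Omega;\mathbb R^3)\cap C^1(B;\mathbb R^3)$, and let $\epsilon,\nu\in L^\infty(\Omega;\mathbb R^{3\times3})\cap C^1(B;\mathbb R^{3\times 3})$ be symmetric and uniformly positive definite a.e. in $\Omega$. Let $\boldsymbol H_0(\mathbf{curl})$ be the closure of $C_0^\infty(\Omega;\mathbb R^3)$ in the norm $(\|\boldsymbol v\|_{L^2}^2+\|\mathbf{curl}\,\boldsymbol v\|_{L^2}^2)^{1/2}$, with dual $\boldsymbol H_0(\mathbf{curl})^*$, and $$a(\boldsymbol v,\boldsymbol w)=\int_\Omega \nu\,\mathbf{curl}\,\boldsymbol v\cdot\mathbf{curl}\,\boldsymbol w\,dx+\int_\Omega\epsilon\,\boldsymbol v\cdot\boldsymbol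 w\,dx .$$ *Admissible shapes.* Fix $L\ge 0$, $r>0$ and $h>0$. Let $\mathcal O$ be the set of all open $\omega\subset B$ that are uniformly Lipschitz with constant $L$: for every $x\in\partial\omega$ there are an orthonormal coordinate system $(y',y_3)\in\mathbb R^2\times\mathbb R$ centred at $x$ and an $L$-Lipschitz function $g:\mathbb R^2\to\mathbb R$ with $g(0)=0$ such that, in the cylinder $\{|y'|<r,\ |y_3|<h\}$, $\omega$ coincides with $\{y_3>g(y')\}$. *Original problem* $(P)$. For $\omega\in\mathcal O$ let $\boldsymbol E(\omega)\in \boldsymbol H_0(\mathbf{curl})$ be the solution of $$a(\boldsymbol E,\boldsymbol v-\boldsymbol E)+j_c\int_\omega|\boldsymbol v|\,dx-j_c\int_\omega|\boldsymbol E|\,dx\ \ge\ \int_\Omega\boldsymbol f\cdot(\boldsymbol v-\boldsymbol E)\,dx\qquad\forall\,\boldsymbol v\in\boldsymbol H_0(\mathbf{curl}).$$ Problem $(P)$ is to minimize $J(\omega)=\frac12\int_B\kappa|\boldsymbol E(\omega)-\boldsymbol E_d|^2dx+\int_\omega dx$ over $\omega\in\mathcal O$. With the multiplier $\boldsymbol\lambda(\omega)\in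 L^\infty(\omega;\mathbb R^3)$, the pair $(\boldsymbol E(\omega),\boldsymbol\lambda(\omega))$ is the solution of $$a(\boldsymbol E,\boldsymbol v)+\int_\omega\boldsymbol\lambda\cdot\boldsymbol v\,dx=\int_\Omega\boldsymbol f\cdot\boldsymbol v\,dx\quad\forall\,\boldsymbol v\in\boldsymbol H_0(\mathbf{curl}),\qquad |\boldsymbol\lambda|\le j_c,\quad \boldsymbol\lambda\cdot\boldsymbol E=j_c|\boldsymbol E|\ \text{ a.e. in }\omega. \tag{1}$$ *Penalized problem* $(P_\gamma)$, $\gamma>0$. Let $(\boldsymbol E^\gamma(\omega),\boldsymbol\lambda^\gamma(\omega))$ be the solution of $$a(\boldsymbol E^\gamma,\boldsymbol v)+\int_\omega\boldsymbol\lambda^\gamma\cdot\boldsymbol v\,dx=\int_\Omega\boldsymbol f\cdot\boldsymbol v\,dx\quad\forall\,\boldsymbol v\in\boldsymbol H_0(\mathbf{curl}),\qquad \boldsymbol\lambda^\gamma=\frac{j_c\gamma\boldsymbol E^\gamma}{\max_\gamma\{1,\gamma|\boldsymbol E^\gamma|\}}\ \text{ a.e. in }\omega,$$ where $\max_\gamma\{1,x\}$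 equals $x$ if $x-1\ge\frac1{2\gamma}$, $1+\frac\gamma2\bigl(x-1+\frac1{2\gamma}\bigr)^2$ if $|x-1|\le\frac1{2\gamma}$, and $1$ if $x-1\le-\frac1{2\gamma}$. Problem $(P_\gamma)$ is to minimize $J_\gamma(\omega)=\frac12\int_B\kappa|\boldsymbol E^\gamma(\omega)-\boldsymbol E_d|^2dx+\int_\omega dx$ over $\omega\in\mathcal O$. **Theorem.** Let $\gamma_n>0$ with $\gamma_n\to\infty$, and for every $n$ let $\omega^{\gamma_n}\in\mathcal O$ be an optimal shape of $(P_{\gamma_n})$. Then there is a subsequence, still denoted by $(\gamma_n)$, and an optimal shape $\omega_\star\in\mathcal O$ of $(P)$ such that $\omega^{\gamma_n}\to\omega_\star$ in the sense of Hausdorff (the complements converge in the Hausdorff distance) and in the sense of characteristic functions ($\chi_{\omega^{\gamma_n}}\to\chi_{\omega_\star}$ in $L^p(\mathbb R^3)$ for every $p\in[1,\infty)$). Moreover, $(1)$ for $\omega=\omega_\star$ has a unique solution $(\boldsymbol E(\omega_\star),\boldsymbol\lambda(\omega_\star))$, and $$\lim_{n\to\infty}\|\boldsymbol E^{\gamma_n}(\omega^{\gamma_n})-\boldsymbol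 E(\omega_\star)\|_{\boldsymbol H_0(\mathbf{curl})}=0,\qquad \lim_{n\to\infty}\|\boldsymbol\lambda^{\gamma_n}(\omega^{\gamma_n})-\boldsymbol\lambda(\omega_\star)\|_{\boldsymbol H_0(\mathbf{curl})^*}=0,$$ where the multipliers are extended by zero to $\Omega$ and act on $\boldsymbol H_0(\mathbf{curl})$ through the $L^2(\Omega;\mathbb R^3)$ inner product. -/

import Mathlib

open MeasureTheory Filter Topology
open scoped ENNReal NNReal

noncomputable section

namespace HTS

/-! ### Function spaces -/

/-- Euclidean space `ℝ³`. -/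
abbrev E3 : Type := EuclideanSpace ℝ (Fin 3)

/-- The space `L²(Ω; ℝ³)`. -/
abbrev L2 (Ω : Set E3) : Type := Lp E3 2 (volume.restrict Ω)

/-- Classical `i`-th partial derivative of the `j`-th component of a vector field. -/
def pd (φ : E3 → E3) (i j : Fin 3) (x : E3) : ℝ :=
  (fderiv ℝ φ x (EuclideanSpace.single i 1)) j

/-- Classical curl of a vector field on `ℝ³`. -/
def curl (φ : E3 → E3) (x : E3) : E3 :=
  !₂[pd φ 1 2 x - pd φ 2 1 x, pd φ 2 0 x - pd φ 0 2 x, pd φ 0 1 x - pd φ 1 0 x]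

/-- `φ ∈ C₀^∞(Ω; ℝ³)`: smooth, with compact support contained in `Ω`. -/
structure IsTest (Ω : Set E3) (φ : E3 → E3) : Prop where
  smooth : ContDiff ℝ (⊤ : ℕ∞) φ
  compact : HasCompactSupport φ
  supp : tsupport φ ⊆ Ω

/-- `w` is the distributional curl of `v` on `Ω`. -/
def HasWeakCurl (Ω : Set E3) (v w : E3 → E3) : Prop :=
  ∀ ψ : E3 → E3, IsTest Ω ψ →
    ∫ x in Ω, inner ℝ (w x) (ψ x) = ∫ x in Ω, inner ℝ (v x) (curl ψ x)

/-- The space `L²(Ω; ℝ³) × L²(Ω; ℝ³)` with the Hilbert norm `(‖v‖² + ‖w‖²)^{1/2}`. A field `v` of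
`H(curl)` is represented by its graph element `(v, curl v)`, and the norm of this space restricted
to such pairs is the `H(curl)`-norm. -/
abbrev Pair (Ω : Set E3) : Type := WithLp 2 (L2 Ω × L2 Ω)

lemma pd_add {φ ψ : E3 → E3} (hφ : Differentiable ℝ φ) (hψ : Differentiable ℝ ψ) (i j : Fin 3)
    (x : E3) : pd (φ + ψ) i j x = pd φ i j x + pd ψ i j x := by
  simp [pd, fderiv_add (hφ x) (hψ x)]

lemma pd_smul {φ : E3 → E3} (hφ : Differentiable ℝ φ) (c : ℝ) (i j : Fin 3)
    (x : E3) : pd (c • φ) i j x = c * pd φ i j x := by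
  simp [pd, fderiv_const_smul (hφ x)]

lemma curl_add {φ ψ : E3 → E3} (hφ : Differentiable ℝ φ) (hψ : Differentiable ℝ ψ) (x : E3) :
    curl (φ + ψ) x = curl φ x + curl ψ x := by
  ext k
  fin_cases k <;> simp [curl, pd_add hφ hψ] <;> ring

lemma curl_smul {φ : E3 → E3} (hφ : Differentiable ℝ φ) (c : ℝ) (x : E3) :
    curl (c • φ) x = c • curl φ x := by
  ext k
  fin_cases k <;> simp [curl, pd_smul hφ] <;> ring

lemma IsTest.differentiable {Ω : Set E3} {φ : E3 → E3} (h : IsTest Ω φ) : Differentiable ℝ φ :=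
  h.smooth.differentiable (by simp)

/-- The graph elements `(φ, curl φ)` of the test fields `φ ∈ C₀^∞(Ω; ℝ³)`. -/
def testPairs (Ω : Set E3) : Submodule ℝ (Pair Ω) where
  carrier := {p | ∃ φ : E3 → E3, IsTest Ω φ ∧
    p.fst =ᵐ[volume.restrict Ω] φ ∧ p.snd =ᵐ[volume.restrict Ω] curl φ}
  zero_mem' := by
    refine ⟨0, ⟨contDiff_const, HasCompactSupport.zero, by simp [tsupport]⟩, ?_, ?_⟩
    · exact Lp.coeFn_zero _ _ _
    · have h : curl 0 = 0 := by
        funext x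
        ext k
        fin_cases k <;> simp [curl, pd]
      rw [h]
      exact Lp.coeFn_zero _ _ _
  add_mem' := by
    rintro p q ⟨φ, hφ, h1, h2⟩ ⟨ψ, hψ, h3, h4⟩
    refine ⟨φ + ψ, ⟨hφ.smooth.add hψ.smooth, hφ.compact.add hψ.compact,
      (tsupport_add φ ψ).trans (Set.union_subset hφ.supp hψ.supp)⟩, ?_, ?_⟩
    · filter_upwards [Lp.coeFn_add p.fst q.fst, h1, h3] with x hx h1 h3
      rw [WithLp.add_fst, hx, Pi.add_apply, h1, h3, Pi.add_apply]
    · filter_upwards [Lp.coeFn_add p.snd q.snd, h2, h4] with x hx h2 h4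
      rw [WithLp.add_snd, hx, Pi.add_apply, h2, h4,
        curl_add hφ.differentiable hψ.differentiable]
  smul_mem' := by
    rintro c p ⟨φ, hφ, h1, h2⟩
    refine ⟨c • φ, ⟨contDiff_const.smul hφ.smooth, hφ.compact.smul_left,
      (closure_mono (Function.support_const_smul_subset c φ)).trans hφ.supp⟩, ?_, ?_⟩
    · filter_upwards [Lp.coeFn_smul c p.fst, h1] with x hx h1
      rw [WithLp.smul_fst, hx, Pi.smul_apply, h1, Pi.smul_apply]
    · filter_upwards [Lp.coeFn_smul c p.snd, h2] with x hx h2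
      rw [WithLp.smul_snd, hx, Pi.smul_apply, h2, curl_smul hφ.differentiable]

/-- `H₀(curl)`: the closure of the test fields with respect to the `H(curl)`-norm, every field `v`
being represented by its graph element `(v, curl v)`. That the second component is indeed the
distributional curl of the first is `hasWeakCurl_fld_rot` below. -/
def H0curl (Ω : Set E3) : Submodule ℝ (Pair Ω) := (testPairs Ω).topologicalClosure

/-- The field `v ∈ L²(Ω; ℝ³)` of an element of `H₀(curl)`. -/
def fld {Ω : Set E3} (v : H0curl Ω) : L2 Ω := (v : Pair Ω).fst

/-- The distributional curl of an element of `H₀(curl)`. -/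
def rot {Ω : Set E3} (v : H0curl Ω) : L2 Ω := (v : Pair Ω).snd

lemma IsTest.hasCompactSupport_pd {Ω : Set E3} {φ : E3 → E3} (h : IsTest Ω φ) (i j : Fin 3) :
    HasCompactSupport (pd φ i j) := by
  have h1 := h.compact.fderiv (𝕜 := ℝ)
  exact h1.comp_left (g := fun A : E3 →L[ℝ] E3 => (A (EuclideanSpace.single i 1)) j) (by simp)

lemma IsTest.continuous_pd {Ω : Set E3} {φ : E3 → E3} (h : IsTest Ω φ) (i j : Fin 3) :
    Continuous (pd φ i j) := by
  have h1 : Continuous (fderiv ℝ φ) := h.smooth.continuous_fderiv (by simp)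
  unfold pd
  fun_prop

lemma integral_pd_mul {Ω : Set E3} {φ ψ : E3 → E3} (hφ : IsTest Ω φ) (hψ : IsTest Ω ψ)
    (i j k : Fin 3) : ∫ x, pd φ i j x * ψ x k = - ∫ x, φ x j * pd ψ i k x := by
  have comp : ∀ {χ : E3 → E3}, IsTest Ω χ → ∀ (l : Fin 3),
      Differentiable ℝ (fun x => χ x l) ∧ Continuous (fun x => χ x l) ∧
      HasCompactSupport (fun x => χ x l) ∧
      ∀ x, fderiv ℝ (fun x => χ x l) x (EuclideanSpace.single i 1) = pd χ i l x := by
    intro χ hχ l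
    have hd := hχ.differentiable
    refine ⟨by fun_prop, ?_, ?_, ?_⟩
    · have := hd.continuous
      fun_prop
    · exact hχ.compact.comp_left (g := fun y : E3 => y l) (by simp)
    · intro x
      have h1 : HasFDerivAt (fun x => χ x l)
          ((EuclideanSpace.proj l : E3 →L[ℝ] ℝ).comp (fderiv ℝ χ x)) x :=
        (EuclideanSpace.proj l : E3 →L[ℝ] ℝ).hasFDerivAt.comp x (hd x).hasFDerivAt
      rw [h1.fderiv]
      rfl
  obtain ⟨d1, c1, s1, e1⟩ := comp hφ j
  obtain ⟨d2, c2, s2, e2⟩ := comp hψ k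
  have key := integral_mul_fderiv_eq_neg_fderiv_mul_of_integrable (μ := (volume : Measure E3))
    (f := fun x => φ x j) (g := fun x => ψ x k) (v := EuclideanSpace.single i 1)
    (by
      simp only [e1]
      exact ((hφ.continuous_pd i j).mul c2).integrable_of_hasCompactSupport
        ((hφ.hasCompactSupport_pd i j).mul_right))
    (by
      simp only [e2]
      exact (c1.mul (hψ.continuous_pd i k)).integrable_of_hasCompactSupport s1.mul_right)
    ((c1.mul c2).integrable_of_hasCompactSupport s1.mul_right)
    (fun x _ => d1 x) (fun x _ => d2 x)
  simp only [e1, e2] at key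
  linarith

lemma IsTest.eq_zero {Ω : Set E3} {φ : E3 → E3} (h : IsTest Ω φ) {x : E3} (hx : x ∉ Ω) :
    φ x = 0 :=
  image_eq_zero_of_notMem_tsupport (fun h' => hx (h.supp h'))

lemma IsTest.continuous_curl {Ω : Set E3} {φ : E3 → E3} (h : IsTest Ω φ) :
    Continuous (curl φ) := by
  have := h.continuous_pd
  unfold curl
  fun_prop

lemma IsTest.hasCompactSupport_curl {Ω : Set E3} {φ : E3 → E3} (h : IsTest Ω φ) :
    HasCompactSupport (curl φ) := by
  have h1 := h.compact.fderiv (𝕜 := ℝ)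
  exact h1.comp_left (g := fun A : E3 →L[ℝ] E3 =>
    !₂[A (EuclideanSpace.single 1 1) 2 - A (EuclideanSpace.single 2 1) 1,
      A (EuclideanSpace.single 2 1) 0 - A (EuclideanSpace.single 0 1) 2,
      A (EuclideanSpace.single 0 1) 1 - A (EuclideanSpace.single 1 1) 0])
    (by ext k; fin_cases k <;> simp)

lemma integral_six {a b c d e f : E3 → ℝ} (ha : Integrable a) (hb : Integrable b)
    (hc : Integrable c) (hd : Integrable d) (he : Integrable e) (hf : Integrable f) :
    ∫ x, ((a x - b x) + (c x - d x)) + (e x - f x) =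
      (((∫ x, a x) - ∫ x, b x) + ((∫ x, c x) - ∫ x, d x)) + ((∫ x, e x) - ∫ x, f x) := by
  have h1 : ∫ x, ((a x - b x) + (c x - d x)) + (e x - f x) =
      (∫ x, (a x - b x) + (c x - d x)) + ∫ x, (e x - f x) :=
    integral_add ((ha.sub hb).add (hc.sub hd)) (he.sub hf)
  have h2 : ∫ x, (a x - b x) + (c x - d x) = (∫ x, (a x - b x)) + ∫ x, (c x - d x) :=
    integral_add (ha.sub hb) (hc.sub hd)
  rw [h1, h2, integral_sub ha hb, integral_sub hc hd, integral_sub he hf]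

/-- The classical curl of a test field is its distributional curl. -/
lemma IsTest.hasWeakCurl {Ω : Set E3} {φ : E3 → E3} (hφ : IsTest Ω φ) :
    HasWeakCurl Ω φ (curl φ) := by
  intro ψ hψ
  rw [setIntegral_eq_integral_of_forall_compl_eq_zero
      (fun x hx => by rw [hψ.eq_zero hx, inner_zero_right]),
    setIntegral_eq_integral_of_forall_compl_eq_zero
      (fun x hx => by rw [hφ.eq_zero hx, inner_zero_left])]
  have cψ : ∀ k, Continuous fun x => ψ x k := fun k => by
    have := hψ.differentiable.continuous
    fun_prop
  have cφ : ∀ k, Continuous fun x => φ x k := fun k => by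
    have := hφ.differentiable.continuous
    fun_prop
  have sφ : ∀ k, HasCompactSupport fun x => φ x k := fun k =>
    hφ.compact.comp_left (g := fun y : E3 => y k) (by simp)
  have I1 : ∀ i j k, Integrable fun x => pd φ i j x * ψ x k := fun i j k =>
    ((hφ.continuous_pd i j).mul (cψ k)).integrable_of_hasCompactSupport
      (hφ.hasCompactSupport_pd i j).mul_right
  have I2 : ∀ i j k, Integrable fun x => φ x j * pd ψ i k x := fun i j k =>
    ((cφ j).mul (hψ.continuous_pd i k)).integrable_of_hasCompactSupport (sφ j).mul_right
  have e1 : ∀ x, inner ℝ (curl φ x) (ψ x) =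
      ((pd φ 1 2 x * ψ x 0 - pd φ 2 1 x * ψ x 0) + (pd φ 2 0 x * ψ x 1 - pd φ 0 2 x * ψ x 1))
        + (pd φ 0 1 x * ψ x 2 - pd φ 1 0 x * ψ x 2) := fun x => by
    simp [curl, PiLp.inner_apply, Fin.sum_univ_three]
    ring
  have e2 : ∀ x, inner ℝ (φ x) (curl ψ x) =
      ((φ x 0 * pd ψ 1 2 x - φ x 0 * pd ψ 2 1 x) + (φ x 1 * pd ψ 2 0 x - φ x 1 * pd ψ 0 2 x))
        + (φ x 2 * pd ψ 0 1 x - φ x 2 * pd ψ 1 0 x) := fun x => by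
    simp [curl, PiLp.inner_apply, Fin.sum_univ_three]
    ring
  simp only [e1, e2]
  rw [integral_six (I1 _ _ _) (I1 _ _ _) (I1 _ _ _) (I1 _ _ _) (I1 _ _ _) (I1 _ _ _),
    integral_six (I2 _ _ _) (I2 _ _ _) (I2 _ _ _) (I2 _ _ _) (I2 _ _ _) (I2 _ _ _)]
  simp only [integral_pd_mul hφ hψ]
  ring

/-- For `v ∈ H₀(curl)`, the second component of the graph element is the distributional curl of
the first one; in particular it is determined by it. -/
theorem hasWeakCurl_fld_rot {Ω : Set E3} (v : H0curl Ω) :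
    HasWeakCurl Ω (fld v) (rot v) := by
  intro ψ hψ
  have m1 : MemLp ψ 2 (volume.restrict Ω) :=
    (hψ.differentiable.continuous.memLp_of_hasCompactSupport hψ.compact)
  have m2 : MemLp (curl ψ) 2 (volume.restrict Ω) :=
    (hψ.continuous_curl.memLp_of_hasCompactSupport hψ.hasCompactSupport_curl)
  have t : ∀ (p : L2 Ω) {χ : E3 → E3} (m : MemLp χ 2 (volume.restrict Ω)),
      inner ℝ p (m.toLp χ) = ∫ x in Ω, inner ℝ (p x) (χ x) := by
    intro p χ m
    rw [L2.inner_def]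
    refine integral_congr_ae ?_
    filter_upwards [m.coeFn_toLp] with x hx
    rw [hx]
  have hcl : IsClosed {p : Pair Ω | inner ℝ p.snd (m1.toLp ψ) = inner ℝ p.fst (m2.toLp (curl ψ))} :=
    isClosed_eq
      (((WithLp.sndL 2 ℝ (L2 Ω) (L2 Ω)).continuous).inner continuous_const)
      (((WithLp.fstL 2 ℝ (L2 Ω) (L2 Ω)).continuous).inner continuous_const)
  have hmem := closure_minimal (s := (testPairs Ω : Set (Pair Ω))) (fun p hp => by
    obtain ⟨φ, hφ, h1, h2⟩ := hp
    show inner ℝ p.snd (m1.toLp ψ) = inner ℝ p.fst (m2.toLp (curl ψ))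
    rw [t, t]
    have := hφ.hasWeakCurl ψ hψ
    rw [integral_congr_ae (g := fun x => inner ℝ (curl φ x) (ψ x)) (by
        filter_upwards [h2] with x hx
        rw [hx]), this]
    refine integral_congr_ae ?_
    filter_upwards [h1] with x hx
    rw [hx]) hcl v.2
  have := hmem
  simp only [Set.mem_ofPred_eq, t] at this
  exact this

/-- The functional `v ↦ ∫_Ω λ · v dx` on `H₀(curl)` given by `λ ∈ L²(Ω; ℝ³)`, as an element of the
dual space `H₀(curl)*` (which carries the operator norm). -/
def toDual {Ω : Set E3} (lam : L2 Ω) : H0curl Ω →L[ℝ] ℝ :=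
  (innerSL ℝ lam).comp ((WithLp.fstL 2 ℝ (L2 Ω) (L2 Ω)).comp (H0curl Ω).subtypeL)

/-! ### Lipschitz sets -/

/-- Near its boundary point `x`, the set `U` is the strict epigraph of an `L`-Lipschitz function, in
the open cylinder of radius `r` and half-height `h` centred at `x`, with respect to some orthonormal
coordinate system centred at `x`. -/
def IsGraphNear (L : ℝ≥0) (r h : ℝ) (U : Set E3) (x : E3) : Prop :=
  ∃ (R : E3 ≃ₗᵢ[ℝ] E3) (g : EuclideanSpace ℝ (Fin 2) → ℝ), LipschitzWith L g ∧ g 0 = 0 ∧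
    ∀ y : E3, ‖(!₂[y 0, y 1] : EuclideanSpace ℝ (Fin 2))‖ < r → |y 2| < h →
      (x + R y ∈ U ↔ g !₂[y 0, y 1] < y 2)

/-- Bounded Lipschitz domain. -/
structure IsLipschitzDomain (U : Set E3) : Prop where
  isOpen : IsOpen U
  isConnected : IsConnected U
  isBounded : Bornology.IsBounded U
  graph : ∀ x ∈ frontier U, ∃ (L : ℝ≥0) (r h : ℝ), 0 < r ∧ 0 < h ∧ IsGraphNear L r h U x

/-- The admissible shapes: open subsets of `B` that are uniformly Lipschitz, i.e. all the local
boundary graphs have Lipschitz constant `L`, over cylinders of a common size `(r, h)`. -/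
def Shapes (B : Set E3) (L : ℝ≥0) (r h : ℝ) : Set (Set E3) :=
  {ω | ω ⊆ B ∧ IsOpen ω ∧ ∀ x ∈ frontier ω, IsGraphNear L r h ω x}

/-- Hausdorff convergence of (uniformly bounded) open sets: the complements converge with respect to
the Hausdorff distance. -/
def HausdorffConv (ω : ℕ → Set E3) (ω' : Set E3) : Prop :=
  Tendsto (fun k => Metric.hausdorffEDist (ω k)ᶜ ω'ᶜ) atTop (𝓝 0)

/-- Convergence in the sense of characteristic functions: `χ_{ω_k} → χ_{ω'}` in `L^p(ℝ³)` for every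
`p ∈ [1, ∞)`. -/
def CharConv (ω : ℕ → Set E3) (ω' : Set E3) : Prop :=
  ∀ p : ℝ≥0∞, 1 ≤ p → p ≠ ∞ →
    Tendsto (fun k => eLpNorm ((ω k).indicator (fun _ => (1 : ℝ)) - ω'.indicator (fun _ => (1 : ℝ)))
      p volume) atTop (𝓝 0)

/-! ### Data of the problem -/

/-- `u` belongs to the Banach space `C¹(B)` on the open set `B`: it is continuously differentiable
on `B`, and bounded there together with its derivative. -/
def IsC1 {F : Type*} [NormedAddCommGroup F] [NormedSpace ℝ F] (B : Set E3) (u : E3 → F) : Prop :=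
  ContDiffOn ℝ 1 u B ∧ ∃ C : ℝ, ∀ x ∈ B, ‖u x‖ ≤ C ∧ ‖fderiv ℝ u x‖ ≤ C

/-- A material tensor: in `L^∞(Ω; ℝ^{3×3}) ∩ C¹(B; ℝ^{3×3})`, symmetric and uniformly positive
definite. -/
structure IsMaterial (Ω B : Set E3) (M : E3 → Matrix (Fin 3) (Fin 3) ℝ) : Prop where
  bounded : ∀ i j, MemLp (fun x => M x i j) ∞ (volume.restrict Ω)
  c1 : ∀ i j, IsC1 B (fun x => M x i j)
  symm : ∀ᵐ x ∂volume.restrict Ω, (M x).IsSymm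
  posDef : ∃ c : ℝ, 0 < c ∧ ∀ᵐ x ∂volume.restrict Ω, ∀ ξ : E3,
    c * ‖ξ‖ ^ 2 ≤ inner ℝ ξ (Matrix.toEuclideanLin (M x) ξ)

/-- The data: the domain `Ω`, the subset `B`, the target `Ed`, the weight `κ`, the critical current
density `jc`, the permittivity `ε`, the reluctivity `ν` and the applied current source `f`. -/
structure Data where
  Ω : Set E3
  B : Set E3
  Ed : E3 → E3
  κ : E3 → ℝ
  jc : ℝ
  ε : E3 → Matrix (Fin 3) (Fin 3) ℝ
  ν : E3 → Matrix (Fin 3) (Fin 3) ℝ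
  f : E3 → E3

/-- The standing assumptions on the data. -/
structure Data.Admissible (D : Data) : Prop where
  domain : IsLipschitzDomain D.Ω
  subset : D.B ⊆ D.Ω
  lipB : IsLipschitzDomain D.B
  target : IsC1 D.B D.Ed
  weight : IsC1 D.B D.κ
  weight_pos : ∀ x ∈ D.B, 0 < D.κ x
  jc_pos : 0 < D.jc
  permittivity : IsMaterial D.Ω D.B D.ε
  reluctivity : IsMaterial D.Ω D.B D.ν
  source : MemLp D.f 2 (volume.restrict D.Ω)
  source_c1 : IsC1 D.B D.f

/-- The regularized maximum `max_γ {1, x}`. -/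
def regMax (γ x : ℝ) : ℝ :=
  if 1 / (2 * γ) ≤ x - 1 then x
  else if |x - 1| ≤ 1 / (2 * γ) then 1 + γ / 2 * (x - 1 + 1 / (2 * γ)) ^ 2
  else 1

namespace Data

variable (D : Data)

/-- The bilinear form `a(v, w) = ∫_Ω ν curl v · curl w dx + ∫_Ω ε v · w dx`. -/
def a (v w : H0curl D.Ω) : ℝ :=
  (∫ x in D.Ω, inner ℝ (Matrix.toEuclideanLin (D.ν x) (rot v x)) (rot w x)) +
    ∫ x in D.Ω, inner ℝ (Matrix.toEuclideanLin (D.ε x) (fld v x)) (fld w x)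

/-- The load `∫_Ω f · v dx`. -/
def load (v : H0curl D.Ω) : ℝ := ∫ x in D.Ω, inner ℝ (D.f x) (fld v x)

/-- The nonsmooth functional `φ_ω(v) = j_c ∫_ω |v| dx`. -/
def phi (ω : Set E3) (v : H0curl D.Ω) : ℝ := D.jc * ∫ x in ω, ‖fld v x‖

/-- `E` solves the variational inequality for the shape `ω`. -/
def IsState (ω : Set E3) (E : H0curl D.Ω) : Prop :=
  ∀ v : H0curl D.Ω, D.load (v - E) ≤ D.a E (v - E) + D.phi ω v - D.phi ω E

/-- `lam ∈ L²(Ω; ℝ³)` is extended by zero outside of `ω`. -/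
def IsZeroExt (ω : Set E3) (lam : L2 D.Ω) : Prop :=
  ∀ᵐ x ∂volume.restrict (D.Ω \ ω), lam x = 0

/-- `(E, lam)` solves the dual formulation of the variational inequality for the shape `ω`; the
multiplier is extended by zero to `Ω`. -/
structure IsDualSol (ω : Set E3) (E : H0curl D.Ω) (lam : L2 D.Ω) : Prop where
  zeroExt : D.IsZeroExt ω lam
  eqn : ∀ v : H0curl D.Ω, D.a E v + ∫ x in ω, inner ℝ (lam x) (fld v x) = D.load v
  bound : ∀ᵐ x ∂volume.restrict ω, ‖lam x‖ ≤ D.jc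
  align : ∀ᵐ x ∂volume.restrict ω, inner ℝ (lam x) (fld E x) = D.jc * ‖fld E x‖

/-- `(E, lam)` solves the penalized dual formulation with parameter `γ` for the shape `ω`; the
multiplier is extended by zero to `Ω`. -/
structure IsPenSol (γ : ℝ) (ω : Set E3) (E : H0curl D.Ω) (lam : L2 D.Ω) : Prop where
  zeroExt : D.IsZeroExt ω lam
  eqn : ∀ v : H0curl D.Ω, D.a E v + ∫ x in ω, inner ℝ (lam x) (fld v x) = D.load v
  law : ∀ᵐ x ∂volume.restrict ω,
    lam x = (D.jc * γ / regMax γ (γ * ‖fld E x‖)) • fld E x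

/-- The cost `½ ∫_B κ |E - Ed|² dx + ∫_ω dx` of a shape `ω` and an electric field `E`. -/
def cost (ω : Set E3) (E : H0curl D.Ω) : ℝ :=
  1 / 2 * (∫ x in D.B, D.κ x * ‖fld E x - D.Ed x‖ ^ 2) + ∫ _x in ω, (1 : ℝ)

/-- `ω` is an optimal shape of the original problem: it minimizes the cost of `(ω, E(ω))` over the
class `O` of shapes, `E(ω)` being the solution of the variational inequality. -/
def IsOptimal (O : Set (Set E3)) (ω : Set E3) : Prop :=
  ω ∈ O ∧ ∃ E, D.IsState ω E ∧ ∀ ω' ∈ O, ∀ E', D.IsState ω' E' → D.cost ω E ≤ D.cost ω' E'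

/-- `ω` is an optimal shape of the penalized problem: it minimizes the cost of `(ω, E^γ(ω))` over
the class `O` of shapes, `E^γ(ω)` being the solution of the penalized dual formulation. -/
def IsPenOptimal (γ : ℝ) (O : Set (Set E3)) (ω : Set E3) : Prop :=
  ω ∈ O ∧ ∃ E lam, D.IsPenSol γ ω E lam ∧
    ∀ ω' ∈ O, ∀ E' lam', D.IsPenSol γ ω' E' lam' → D.cost ω E ≤ D.cost ω' E'

end Data

end HTS

end

namespace HTS

/-! ### Compactness of the class of admissible shapes -/

/-! The argument rests on compactness of the shapes and on a quantitative stability estimate for the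
states; no weak compactness of the states is needed.

Shapes. The traces of the complements on a large closed ball lie in a compact Hausdorff hyperspace,
so a subsequence converges. The charts have a common size and Lipschitz constant, so their
isometries and graph functions have limits, and these limits are charts of the limit set
(`IsGraphNear.of_tendsto`). Hence the limit is admissible. The boundary of the limit is null, and
points off its closure eventually leave the approximating shapes, because otherwise boundary points,
and with them charts, would converge there. So the indicators converge almost everywhere, and the
symmetric differences have measure tending to zero (`HausdorffConv.charConv`).

States. A penalized state solves the variational inequality up to an error of order `1/γ`, uniformly
in the shape (`IsPenSol.isApproxState`). Testing two approximate inequalities with each other's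
solution, coercivity bounds the squared distance of the solutions by their errors plus a multiple of
the square root of the measure of the symmetric difference (`IsApproxState.norm_sub_sq_le`). This
gives uniqueness, existence (penalized states on a fixed shape are Cauchy) and strong convergence
along converging shapes (`tendsto_penSol`). The penalized equation itself is solved by
Zarantonello's theorem.

Optimality. On a fixed competitor the penalized states converge to the exact one, and the cost is
continuous, so the penalized minimality inequality passes to the limit.

Multipliers. Hahn–Banach applied to the residual of the state gives the exact multiplier
(`exists_multiplier`), and density of test fields makes it unique. Subtracting the two equations
expresses the difference of the multipliers through the difference of the states, so the dual norm
convergence follows although the multipliers need not converge in `L²`. -/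

/-- The horizontal part of a point of `ℝ³`. -/
noncomputable def horiz (y : E3) : EuclideanSpace ℝ (Fin 2) := !₂[y 0, y 1]

lemma continuous_horiz : Continuous horiz := by
  unfold horiz
  fun_prop

lemma norm_horiz_sub_le (y z : E3) : ‖horiz y - horiz z‖ ≤ ‖y - z‖ := by
  rw [EuclideanSpace.norm_eq, EuclideanSpace.norm_eq]
  apply Real.sqrt_le_sqrt
  simp only [horiz, Fin.sum_univ_two, Fin.sum_univ_three]
  simp
  positivity

/-- The point of `ℝ³` lying `t` above `y`. -/
noncomputable def lift (y : E3) (t : ℝ) : E3 := y + t • EuclideanSpace.single 2 1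

lemma horiz_lift (y : E3) (t : ℝ) : horiz (lift y t) = horiz y := by
  ext i
  fin_cases i <;> simp [horiz, lift]

lemma lift_two (y : E3) (t : ℝ) : lift y t 2 = y 2 + t := by
  simp [lift]

lemma norm_lift_sub (y : E3) (t : ℝ) : ‖lift y t - y‖ = |t| := by
  simp [lift, norm_smul]

lemma tendsto_compl_point {l : Filter ℕ} {ω : ℕ → Set E3} {ω' : Set E3}
    (hω : Tendsto (fun n => Metric.hausdorffEDist (ω n)ᶜ ω'ᶜ) l (𝓝 0)) {p : E3} (hp : p ∉ ω')
    {ε : ℝ} (hε : 0 < ε) : ∀ᶠ n in l, ∃ z, z ∉ ω n ∧ dist z p < ε := by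
  filter_upwards [hω.eventually_lt_const (ENNReal.ofReal_pos.2 hε)] with n hn
  rw [Metric.hausdorffEDist_comm] at hn
  obtain ⟨z, hz, hz'⟩ := Metric.exists_edist_lt_of_hausdorffEDist_lt hp hn
  exact ⟨z, hz, by rwa [edist_dist, ENNReal.ofReal_lt_ofReal_iff hε, dist_comm] at hz'⟩

/-- If the `δ`-ball around `p` lies in `ω'`, a point of the `δ / 2`-ball outside `ω n` would have a
point of `ω'ᶜ` within `δ / 2`, hence inside the `δ`-ball. -/
lemma eventually_ball_subset {l : Filter ℕ} {ω : ℕ → Set E3} {ω' : Set E3} (ho : IsOpen ω')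
    (hω : Tendsto (fun n => Metric.hausdorffEDist (ω n)ᶜ ω'ᶜ) l (𝓝 0)) {p : E3} (hp : p ∈ ω') :
    ∃ δ > 0, ∀ᶠ n in l, Metric.ball p δ ⊆ ω n := by
  obtain ⟨δ, hδ, hb⟩ := Metric.isOpen_iff.1 ho p hp
  refine ⟨δ / 2, half_pos hδ, ?_⟩
  filter_upwards [hω.eventually_lt_const (ENNReal.ofReal_pos.2 (half_pos hδ))] with n hn y hy
  by_contra hyn
  obtain ⟨z, hz, hz'⟩ := Metric.exists_edist_lt_of_hausdorffEDist_lt (x := y) hyn hn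
  rw [edist_dist, ENNReal.ofReal_lt_ofReal_iff (half_pos hδ)] at hz'
  refine hz (hb ?_)
  rw [Metric.mem_ball] at hy ⊢
  linarith [dist_triangle_left z p y]

/-- Hausdorff limits of complements inherit the local graph representation. -/
theorem IsGraphNear.of_tendsto {L : ℝ≥0} {r h : ℝ} {l : Filter ℕ} [NeBot l] {ω : ℕ → Set E3}
    {ω' : Set E3} {x : ℕ → E3} {x' : E3} (ho : IsOpen ω')
    (hω : Tendsto (fun n => Metric.hausdorffEDist (ω n)ᶜ ω'ᶜ) l (𝓝 0))
    (hx : Tendsto x l (𝓝 x')) (hg : ∀ᶠ n in l, IsGraphNear L r h (ω n) (x n)) :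
    IsGraphNear L r h ω' x' := by
  -- Along an ultrafilter every bounded family converges, so the graph functions have limits at all
  -- points simultaneously, without any diagonal extraction.
  set u : Ultrafilter ℕ := Ultrafilter.of l
  have hul : (u : Filter ℕ) ≤ l := Ultrafilter.of_le l
  replace hω := hω.mono_left hul
  replace hx := hx.mono_left hul
  replace hg := hul hg
  have hg' : ∀ᶠ n in (u : Filter ℕ), ∃ (A : E3 →L[ℝ] E3) (g : EuclideanSpace ℝ (Fin 2) → ℝ),
      (∀ v, ‖A v‖ = ‖v‖) ∧ LipschitzWith L g ∧ g 0 = 0 ∧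
      ∀ y : E3, ‖horiz y‖ < r → |y 2| < h → (x n + A y ∈ ω n ↔ g (horiz y) < y 2) := by
    filter_upwards [hg] with n ⟨R, g, h1, h2, h3⟩
    exact ⟨R.toContinuousLinearEquiv, g, fun v => R.norm_map v, h1, h2, h3⟩
  obtain ⟨A, hA⟩ := hg'.choice
  obtain ⟨g, hAg⟩ := hA.choice
  -- the limit of the coordinate systems
  obtain ⟨A', -, hA'⟩ := (isCompact_closedBall (0 : E3 →L[ℝ] E3) 1).ultrafilter_le_nhds'
    (u.map A) (by
      show ∀ᶠ n in (u : Filter ℕ), A n ∈ Metric.closedBall 0 1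
      filter_upwards [hAg] with n hn
      rw [mem_closedBall_zero_iff]
      exact ContinuousLinearMap.opNorm_le_bound _ zero_le_one (fun v => by rw [hn.1 v, one_mul]))
  replace hA' : Tendsto A u (𝓝 A') := hA'
  have hAv : ∀ v, Tendsto (fun n => A n v) u (𝓝 (A' v)) := fun v =>
    ((ContinuousLinearMap.apply ℝ E3 v).continuous.tendsto A').comp hA'
  have hiso : ∀ v, ‖A' v‖ = ‖v‖ := fun v =>
    tendsto_nhds_unique (hAv v).norm
      (tendsto_const_nhds.congr' (by filter_upwards [hAg] with n hn using (hn.1 v).symm))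
  -- A linear isometry between spaces of equal finite dimension is onto; `rfl` is the equality of
  -- the dimensions.
  let R' : E3 ≃ₗᵢ[ℝ] E3 := LinearIsometry.toLinearIsometryEquiv ⟨A'.toLinearMap, hiso⟩ rfl
  have hR' : ∀ v, R' v = A' v := fun v => rfl
  -- the limit of the graphs
  have hgv : ∀ v, ∃ c, Tendsto (fun n => g n v) u (𝓝 c) := by
    intro v
    obtain ⟨c, -, hc⟩ := (isCompact_closedBall (0 : ℝ) (L * ‖v‖)).ultrafilter_le_nhds'
      (u.map fun n => g n v) (by
        show ∀ᶠ n in (u : Filter ℕ), g n v ∈ Metric.closedBall 0 (L * ‖v‖)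
        filter_upwards [hAg] with n hn
        have := hn.2.1.dist_le_mul v 0
        rwa [hn.2.2.1, dist_zero_right (a := v)] at this)
    exact ⟨c, hc⟩
  choose g' hg' using hgv
  refine ⟨R', g', LipschitzWith.of_dist_le_mul fun v w => ?_, ?_, ?_⟩
  · refine le_of_tendsto ((hg' v).dist (hg' w)) ?_
    filter_upwards [hAg] with n hn using hn.2.1.dist_le_mul v w
  · exact tendsto_nhds_unique (hg' 0)
      (tendsto_const_nhds.congr' (by filter_upwards [hAg] with n hn using hn.2.2.1.symm))
  intro y hy1 hy2
  change ‖horiz y‖ < r at hy1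
  change _ ↔ g' (horiz y) < y 2
  rw [hR']
  have hpn : Tendsto (fun n => x n + A n y) u (𝓝 (x' + A' y)) := hx.add (hAv y)
  constructor
  · intro hp
    obtain ⟨δ, hδ, hball⟩ := eventually_ball_subset ho hω hp
    -- A strict inequality would only survive as `≤` in the limit. Membership is therefore tested at
    -- the point lowered by `t`, which still lies in the ball and in the cylinder; this leaves a gap
    -- `t`.
    obtain ⟨t, ht0, ht1, ht2⟩ : ∃ t : ℝ, 0 < t ∧ t < δ / 2 ∧ t < h - |y 2| := by
      obtain ⟨t, h1, h2⟩ := exists_between (lt_min (half_pos hδ) (sub_pos.2 hy2))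
      exact ⟨t, h1, (lt_min_iff.1 h2).1, (lt_min_iff.1 h2).2⟩
    have key : ∀ᶠ n in (u : Filter ℕ), g n (horiz y) ≤ y 2 + -t := by
      filter_upwards [hball, hAg, hpn.eventually (Metric.ball_mem_nhds _ (half_pos hδ))]
        with n h1 h2 h3
      have h4 := h2.2.2.2 (lift y (-t)) (by rwa [horiz_lift]) (by
        rw [lift_two]
        refine lt_of_le_of_lt (abs_add_le _ _) ?_
        rw [abs_neg, abs_of_pos ht0]; linarith)
      rw [horiz_lift, lift_two] at h4
      refine (h4.1 (h1 ?_)).le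
      rw [Metric.mem_ball]
      have h5 : dist (x n + A n (lift y (-t))) (x n + A n y) < δ / 2 := by
        rw [dist_add_left, dist_eq_norm, ← map_sub, h2.1, norm_lift_sub, abs_neg, abs_of_pos ht0]
        exact ht1
      linarith [dist_triangle (x n + A n (lift y (-t))) (x n + A n y) (x' + A' y)]
    have := le_of_tendsto (hg' (horiz y)) key
    linarith
  · intro hlt
    by_contra hp
    -- close to `y`, the graph inequality persists
    obtain ⟨ε, hε, hball⟩ : ∃ ε > 0, ∀ z : E3, dist z y < ε →
        ‖horiz z‖ < r ∧ |z 2| < h ∧ ‖z - y‖ * L + |z 2 - y 2| < (y 2 - g' (horiz y)) / 2 := by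
      have c1 : ∀ᶠ z in 𝓝 y, ‖horiz z‖ < r :=
        (continuous_horiz.norm.continuousAt).eventually_lt_const hy1
      have c2 : ∀ᶠ z : E3 in 𝓝 y, |z 2| < h := by
        have : Continuous fun z : E3 => |z 2| := by fun_prop
        exact this.continuousAt.eventually_lt_const hy2
      have c3 : ∀ᶠ z : E3 in 𝓝 y, ‖z - y‖ * L + |z 2 - y 2| < (y 2 - g' (horiz y)) / 2 := by
        have : Continuous fun z : E3 => ‖z - y‖ * (L : ℝ) + |z 2 - y 2| := by fun_prop
        refine this.continuousAt.eventually_lt_const ?_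
        simpa using hlt
      exact Metric.eventually_nhds_iff.1 (c1.and (c2.and c3))
    -- Otherwise points of `(ω n)ᶜ` come close to `x' + A' y`. Pulled back by the `n`-th chart they
    -- are close to `y`, where half of the gap pays for replacing `g'` by `g n` and half for moving
    -- the point, so they lie above the graph and hence in `ω n`.
    have hz := tendsto_compl_point hω hp (half_pos hε)
    have key : ∀ᶠ n in (u : Filter ℕ), False := by
      filter_upwards [hz, hAg, hpn.eventually (Metric.ball_mem_nhds _ (half_pos hε)),
        (hg' (horiz y)).eventually_lt_const
          (show g' (horiz y) < g' (horiz y) + (y 2 - g' (horiz y)) / 2 by linarith)]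
        with n ⟨z, hz1, hz2⟩ h2 h3 h4
      let Rn : E3 ≃ₗᵢ[ℝ] E3 := LinearIsometry.toLinearIsometryEquiv ⟨(A n).toLinearMap, h2.1⟩ rfl
      have hRn : ∀ v, Rn v = A n v := fun v => rfl
      obtain ⟨w, hw⟩ := Rn.surjective (z - x n)
      rw [hRn] at hw
      have hwy : dist w y < ε := by
        have : dist w y = dist z (x n + A n y) := by
          rw [dist_eq_norm, ← h2.1, map_sub, hw, dist_eq_norm]
          congr 1
          abel
        rw [this]
        linarith [dist_triangle_right z (x n + A n y) (x' + A' y)]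
      obtain ⟨b1, b2, b3⟩ := hball w hwy
      have hiff := h2.2.2.2 w b1 b2
      rw [hw, add_sub_cancel] at hiff
      refine hz1 (hiff.2 ?_)
      have l1 := h2.2.1.dist_le_mul (horiz w) (horiz y)
      rw [Real.dist_eq, dist_eq_norm] at l1
      have l2 := (abs_le.1 l1).2
      have l3 := mul_le_mul_of_nonneg_left (norm_horiz_sub_le w y) L.2
      have l4 := neg_abs_le (w 2 - y 2)
      change (L : ℝ) * _ ≤ (L : ℝ) * _ at l3
      linarith
    exact key.exists.choose_spec

/-- As `g 0 = 0`, the points slightly above the centre of the chart belong to `U`. -/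
lemma IsGraphNear.mem_closure {L : ℝ≥0} {r h : ℝ} (hr : 0 < r) (hh : 0 < h) {U : Set E3} {x : E3}
    (H : IsGraphNear L r h U x) : x ∈ closure U := by
  obtain ⟨R, g, -, g0, H⟩ := H
  rw [Metric.mem_closure_iff]
  intro ε hε
  obtain ⟨t, ht, ht'⟩ := exists_between (lt_min hε hh)
  have h0 : horiz (0 : E3) = 0 := by
    ext i; fin_cases i <;> simp [horiz]
  have h1 := H (lift 0 t) (by
    change ‖horiz _‖ < r
    rw [horiz_lift, h0]; simpa using hr) (by
    rw [lift_two, PiLp.zero_apply, zero_add, abs_of_pos ht]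
    exact (lt_min_iff.1 ht').2)
  change _ ↔ g (horiz _) < _ at h1
  rw [horiz_lift, h0, g0, lift_two] at h1
  refine ⟨_, h1.2 (by simpa using ht), ?_⟩
  have h2 := norm_lift_sub 0 t
  rw [sub_zero, abs_of_pos ht] at h2
  rw [dist_self_add_right, LinearIsometryEquiv.norm_map, h2]
  exact (lt_min_iff.1 ht').1

/-- A segment missing the frontier would be split by the disjoint open sets `interior U` and
`interior Uᶜ`, against connectedness. -/
lemma exists_frontier_mem_segment {U : Set E3} {p z : E3} (hp : p ∈ U) (hz : z ∉ U) :
    ∃ q ∈ segment ℝ p z, q ∈ frontier U := by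
  by_contra! hcon
  have hs : IsPreconnected (segment ℝ p z) := (convex_segment p z).isPreconnected
  have hint : ∀ q ∈ segment ℝ p z, q ∈ interior U ∨ q ∈ interior Uᶜ := by
    intro q hq
    have := hcon q hq
    rw [frontier, Set.mem_sdiff, not_and_not_right] at this
    by_cases h : q ∈ closure U
    · exact Or.inl (this h)
    · right
      rwa [interior_compl]
  obtain ⟨q, -, hq1, hq2⟩ := hs (interior U) (interior Uᶜ) isOpen_interior isOpen_interior
    (fun q hq => hint q hq)
    ⟨p, left_mem_segment ℝ p z, (hint p (left_mem_segment ℝ p z)).resolve_right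
      fun h' => interior_subset h' hp⟩
    ⟨z, right_mem_segment ℝ p z, (hint z (right_mem_segment ℝ p z)).resolve_left
      fun h' => hz (interior_subset h')⟩
  exact interior_subset hq2 (interior_subset hq1)

/-- A frontier point of `ω n` between points of `ω n` and of its complement, both near `x`. -/
lemma exists_frontier_dist_lt {U : Set E3} {p z x : E3} {ε : ℝ} (hp : p ∈ U) (hz : z ∉ U)
    (hpx : dist p x < ε) (hzx : dist z x < ε) : ∃ q ∈ frontier U, dist q x < ε := by
  obtain ⟨q, hq, hq'⟩ := exists_frontier_mem_segment hp hz
  exact ⟨q, hq', (convex_ball x ε).segment_subset hpx hzx hq⟩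

/-- Take `q n` in `S n` nearest to `x` up to `1 / (n + 1)`; the slack vanishes along `l` because `l
≤ atTop`. Where `S n` is empty, `q n` is the irrelevant value `0`. -/
lemma exists_tendsto_of_forall_eventually {l : Filter ℕ} (hl : l ≤ atTop) {S : ℕ → Set E3} {x : E3}
    (H : ∀ ε > 0, ∀ᶠ n in l, ∃ q ∈ S n, dist q x < ε) :
    ∃ q : ℕ → E3, Tendsto q l (𝓝 x) ∧ ∀ᶠ n in l, q n ∈ S n := by
  classical
  have hne : ∀ᶠ n in l, (S n).Nonempty := by
    filter_upwards [H 1 one_pos] with n ⟨q, hq, _⟩ using ⟨q, hq⟩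
  have hch : ∀ n, ∃ q, (S n).Nonempty → q ∈ S n ∧
      dist q x < Metric.infDist x (S n) + 1 / ((n : ℝ) + 1) := by
    intro n
    by_cases hn : (S n).Nonempty
    · obtain ⟨q, hq, hq'⟩ := (Metric.infDist_lt_iff hn).1
        (lt_add_of_pos_right (Metric.infDist x (S n)) (Nat.one_div_pos_of_nat (α := ℝ) (n := n)))
      exact ⟨q, fun _ => ⟨hq, by rwa [dist_comm]⟩⟩
    · exact ⟨0, fun h => absurd h hn⟩
  choose q hq using hch
  refine ⟨q, ?_, by filter_upwards [hne] with n hn using (hq n hn).1⟩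
  rw [Metric.tendsto_nhds]
  intro ε hε
  filter_upwards [H (ε / 2) (half_pos hε), hne,
    hl (tendsto_one_div_add_atTop_nhds_zero_nat.eventually_lt_const (half_pos hε))]
    with n ⟨y, hy, hyx⟩ hn h3
  have h1 := (hq n hn).2
  have h2 := Metric.infDist_le_dist_of_mem (x := x) hy
  rw [dist_comm] at hyx
  change 1 / ((n : ℝ) + 1) < ε / 2 at h3
  linarith

/-- Hausdorff limits of uniformly Lipschitz sets are uniformly Lipschitz. -/
theorem isGraphNear_of_mem_frontier {L : ℝ≥0} {r h : ℝ} {ω : ℕ → Set E3} {ω' : Set E3}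
    (ho : IsOpen ω') (hω : HausdorffConv ω ω')
    (hg : ∀ n, ∀ x ∈ frontier (ω n), IsGraphNear L r h (ω n) x) {x : E3} (hx : x ∈ frontier ω') :
    IsGraphNear L r h ω' x := by
  have hx' : x ∉ ω' := by
    rw [ho.frontier_eq] at hx
    exact hx.2
  -- Near `x` there are a point of `ω'`, which eventually belongs to `ω n`, and a point of `(ω n)ᶜ`;
  -- the segment between them meets the frontier of `ω n`. So `x` is a limit of chart centres.
  obtain ⟨q, hq, hq'⟩ := exists_tendsto_of_forall_eventually (l := atTop) le_rfl
    (S := fun n => frontier (ω n)) (x := x) (fun ε hε => by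
      obtain ⟨p, hp, hpx⟩ := Metric.mem_closure_iff.1 (frontier_subset_closure hx) ε hε
      obtain ⟨δ, hδ, hb⟩ := eventually_ball_subset ho hω hp
      filter_upwards [hb, tendsto_compl_point hω hx' hε] with n h1 ⟨z, hz, hzx⟩
      exact exists_frontier_dist_lt (h1 (Metric.mem_ball_self hδ)) hz
        (by rwa [dist_comm]) hzx)
  exact IsGraphNear.of_tendsto ho hω hq (hq'.mono fun n hn => hg n _ hn)

/-- Away from the limit closure, points eventually leave uniformly Lipschitz sets. -/
theorem eventually_not_mem {L : ℝ≥0} {r h : ℝ} (hr : 0 < r) (hh : 0 < h) {ω : ℕ → Set E3}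
    {ω' : Set E3} (ho : IsOpen ω') (hω : HausdorffConv ω ω')
    (hg : ∀ n, ∀ x ∈ frontier (ω n), IsGraphNear L r h (ω n) x) {x : E3} (hx : x ∉ closure ω') :
    ∀ᶠ n in atTop, x ∉ ω n := by
  by_contra hcon
  have hfreq : ∃ᶠ n in atTop, x ∈ ω n := by
    intro h
    exact hcon h
  -- Along the indices with `x ∈ ω n`, nearby complement points force frontier points tending to
  -- `x`. The limit chart at `x` then puts `x` in the closure of `ω'`.
  have hne : NeBot (atTop ⊓ 𝓟 {n | x ∈ ω n}) := frequently_mem_iff_neBot.1 hfreq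
  have hω' := hω.mono_left (inf_le_left : atTop ⊓ 𝓟 {n | x ∈ ω n} ≤ atTop)
  obtain ⟨q, hq, hq'⟩ := exists_tendsto_of_forall_eventually
    (l := atTop ⊓ 𝓟 {n | x ∈ ω n}) inf_le_left
    (S := fun n => frontier (ω n)) (x := x) (fun ε hε => by
      filter_upwards [tendsto_compl_point hω' (fun h' => hx (subset_closure h')) hε,
        mem_inf_of_right (mem_principal_self _)] with n ⟨z, hz, hzx⟩ hn
      exact exists_frontier_dist_lt hn hz (by simpa using hε) hzx)
  exact hx ((IsGraphNear.of_tendsto ho hω' hq (hq'.mono fun n hn => hg n _ hn)).mem_closure hr hh)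

/-! ### Null boundaries and convergence of characteristic functions -/

/-- The frontier of a set with local graph representations is a null set. -/
theorem volume_frontier_eq_zero {L : ℝ≥0} {r h : ℝ} (hr : 0 < r) (hh : 0 < h) {U : Set E3}
    (hg : ∀ x ∈ frontier U, IsGraphNear L r h U x) : volume (frontier U) = 0 := by
  refine measure_null_of_locally_null _ fun x hx => ?_
  obtain ⟨R, g, gL, -, H⟩ := hg x hx
  have hgc : Continuous fun y : E3 => g (horiz y) := gL.continuous.comp continuous_horiz
  have h2c : Continuous fun y : E3 => y 2 := by fun_prop
  let e : E3 → E3 := fun q => R.symm (q - x)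
  have he : Continuous e := R.symm.continuous.comp (continuous_id.sub continuous_const)
  have hinv : ∀ q, x + R (e q) = q := fun q => by simp [e]
  let S : Set E3 := {q | g (horiz (e q)) = e q 2}
  let V : Set E3 := {q | ‖horiz (e q)‖ < r ∧ |e q 2| < h}
  have hV : IsOpen V :=
    (isOpen_lt (continuous_horiz.comp he).norm continuous_const).inter
      (isOpen_lt (h2c.comp he).abs continuous_const)
  have hxV : x ∈ V := by
    have h0 : horiz (0 : E3) = 0 := by ext i; fin_cases i <;> simp [horiz]
    simp [V, e, h0, hr, hh]
  -- The vertical translates of a graph by the distinct heights `1 / (n + 1)` are pairwise disjoint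
  -- and the translation vectors are bounded, which is impossible for a set of positive measure.
  have hS : volume S = 0 := by
    refine Measure.addHaar_eq_zero_of_disjoint_translates volume
      (fun n : ℕ => (1 / ((n : ℝ) + 1)) • R (EuclideanSpace.single 2 1)) ?_ ?_ ?_
    · rw [isBounded_iff_forall_norm_le]
      refine ⟨1, ?_⟩
      rintro _ ⟨n, rfl⟩
      rw [norm_smul, R.norm_map, Real.norm_of_nonneg (by positivity)]
      simp only [PiLp.norm_single, norm_one, mul_one]
      rw [div_le_one (by positivity)]
      linarith [n.cast_nonneg (α := ℝ)]
    · intro m n hmn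
      refine Set.disjoint_left.2 ?_
      rintro _ ⟨_, rfl, p, hp, rfl⟩ ⟨_, rfl, q, hq, hpq⟩
      have hlift : e q = lift (e p) (1 / ((m : ℝ) + 1) - 1 / ((n : ℝ) + 1)) := by
        have : q = p + (1 / ((m : ℝ) + 1) - 1 / ((n : ℝ) + 1)) • R (EuclideanSpace.single 2 1) := by
          have hpq' := eq_sub_of_add_eq' hpq
          rw [hpq', sub_smul]
          simp only []
          abel
        rw [this]
        simp only [e, lift, map_sub, map_add, map_smul, R.symm_apply_apply]
        abel
      have hq' : g (horiz (e q)) = e q 2 := hq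
      have hp' : g (horiz (e p)) = e p 2 := hp
      rw [hlift, horiz_lift, lift_two, hp'] at hq'
      have h3 : 1 / ((m : ℝ) + 1) = 1 / ((n : ℝ) + 1) := by linarith
      rw [one_div, one_div, inv_inj, add_left_inj, Nat.cast_inj] at h3
      exact hmn h3
    · exact (isClosed_eq (hgc.comp he) (h2c.comp he)).measurableSet
  refine ⟨S, ?_, hS⟩
  rw [mem_nhdsWithin]
  refine ⟨V, hV, hxV, ?_⟩
  rintro q ⟨hqV, hq⟩
  have hiff : ∀ q ∈ V, q ∈ U ↔ g (horiz (e q)) < e q 2 := fun q hq => by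
    have := H (e q) hq.1 hq.2
    rwa [hinv] at this
  -- Off the graph, strict inequality is an open condition, so `q` would be interior to `U` or to
  -- `Uᶜ` and not on the frontier.
  by_contra hne
  rcases lt_or_gt_of_ne (show g (horiz (e q)) ≠ e q 2 from hne) with h1 | h1
  · refine hq.2 (mem_interior.2 ⟨V ∩ {q | g (horiz (e q)) < e q 2}, ?_, ?_, hqV, h1⟩)
    · exact fun p hp => (hiff p hp.1).2 hp.2
    · exact hV.inter (isOpen_lt (hgc.comp he) (h2c.comp he))
  · refine Set.disjoint_left.1 (disjoint_interior_frontier (s := Uᶜ)) (mem_interior.2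
      ⟨V ∩ {q | e q 2 < g (horiz (e q))}, ?_, ?_, hqV, h1⟩) (by rwa [frontier_compl])
    · exact fun p hp hpU => lt_asymm hp.2 ((hiff p hp.1).1 hpU)
    · exact hV.inter (isOpen_lt (h2c.comp he) (hgc.comp he))

/-- Dominated convergence: off the null frontier of `ω'`, each point is eventually in both `ω n` and
`ω'` or in neither. The `L^p` norm of the difference of indicators is a power of the measure of the
symmetric difference. -/
lemma HausdorffConv.charConv {L : ℝ≥0} {r h : ℝ} (hr : 0 < r) (hh : 0 < h) {B : Set E3}
    (hB : Bornology.IsBounded B) {ω : ℕ → Set E3} {ω' : Set E3}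
    (hω : HausdorffConv ω ω') (hS : ∀ n, ω n ∈ Shapes B L r h) (hS' : ω' ∈ Shapes B L r h) :
    CharConv ω ω' ∧ Tendsto (fun n => volume (symmDiff (ω n) ω')) atTop (𝓝 0) := by
  have hmeas : ∀ n, MeasurableSet (symmDiff (ω n) ω') := fun n =>
    (hS n).2.1.measurableSet.symmDiff hS'.2.1.measurableSet
  have hvol : Tendsto (fun n => volume (symmDiff (ω n) ω')) atTop (𝓝 0) := by
    -- The dominating indicator is that of `closure B`, which is measurable without any openness
    -- assumption on `B`.
    have hBv : volume (closure B) ≠ ∞ := hB.closure.measure_lt_top.ne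
    have key := tendsto_lintegral_of_dominated_convergence (μ := (volume : Measure E3))
      (F := fun n => (symmDiff (ω n) ω').indicator (fun _ => (1 : ℝ≥0∞))) (f := fun _ => 0)
      ((closure B).indicator fun _ => 1)
      (fun n => measurable_one.indicator (hmeas n))
      (fun n => ae_of_all _ fun x => by
        refine Set.indicator_le_indicator_of_subset ?_ (fun _ => zero_le) x
        intro y hy
        rcases hy with hy | hy
        · exact subset_closure ((hS n).1 hy.1)
        · exact subset_closure (hS'.1 hy.1))
      (by
        rw [lintegral_indicator isClosed_closure.measurableSet]
        simpa using hBv)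
      (by
        have hz := volume_frontier_eq_zero hr hh hS'.2.2
        filter_upwards [measure_eq_zero_iff_ae_notMem.1 hz] with x hx
        refine tendsto_const_nhds.congr' ?_
        by_cases hx' : x ∈ ω'
        · obtain ⟨δ, hδ, hb⟩ := eventually_ball_subset hS'.2.1 hω hx'
          filter_upwards [hb] with n hn
          have := hn (Metric.mem_ball_self hδ)
          rw [Set.indicator_of_notMem]
          simp [Set.mem_symmDiff, this, hx']
        · have hxc : x ∉ closure ω' := fun hc => hx (by
            rw [hS'.2.1.frontier_eq]
            exact ⟨hc, hx'⟩)
          filter_upwards [eventually_not_mem hr hh hS'.2.1 hω (fun n => (hS n).2.2) hxc] with n hn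
          rw [Set.indicator_of_notMem]
          simp [Set.mem_symmDiff, hn, hx'])
    simp only [lintegral_zero] at key
    refine key.congr fun n => ?_
    rw [lintegral_indicator (hmeas n)]
    simp
  refine ⟨fun p hp hp' => ?_, hvol⟩
  have hp0 : p ≠ 0 := (zero_lt_one.trans_le hp).ne'
  have hpr : 0 < p.toReal := ENNReal.toReal_pos hp0 hp'
  have heq : ∀ n, eLpNorm ((ω n).indicator (fun _ => (1 : ℝ)) - ω'.indicator (fun _ => (1 : ℝ)))
      p volume = volume (symmDiff (ω n) ω') ^ (1 / p.toReal) := fun n => by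
    rw [eLpNorm_congr_norm_ae (g := (symmDiff (ω n) ω').indicator (fun _ => (1 : ℝ)))
      (ae_of_all _ fun x => ?_), eLpNorm_indicator_const (hmeas n) hp0 hp']
    · simp
    · by_cases h1 : x ∈ ω n <;> by_cases h2 : x ∈ ω' <;>
        simp [Set.indicator, Set.mem_symmDiff, h1, h2]
  simp only [heq]
  have hc := (ENNReal.continuous_rpow_const (y := 1 / p.toReal)).tendsto 0
  rw [ENNReal.zero_rpow_of_pos (by positivity)] at hc
  exact hc.comp hvol

/-! ### Sequential compactness of the admissible shapes -/

/-- Every sequence of admissible shapes has a subsequence that converges in the sense of Hausdorff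
to an admissible shape. -/
theorem exists_subseq_hausdorffConv {L : ℝ≥0} {r h : ℝ} {B : Set E3} (hBo : IsOpen B)
    (hB : Bornology.IsBounded B) {ω : ℕ → Set E3} (hS : ∀ n, ω n ∈ Shapes B L r h) :
    ∃ s : ℕ → ℕ, StrictMono s ∧ ∃ ω' ∈ Shapes B L r h, HausdorffConv (fun k => ω (s k)) ω' := by
  obtain ⟨ρ, hρ⟩ := hB.subset_closedBall (0 : E3)
  let K : Set E3 := Metric.closedBall 0 ρ
  have : CompactSpace K := isCompact_iff_compactSpace.1 (isCompact_closedBall _ _)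
  -- The complements are unbounded, so only their traces on the compact ball `K ⊇ B` enter the
  -- compact space of closed sets; the common part `Kᶜ` is added back afterwards and does not
  -- increase the distance.
  let C : ℕ → TopologicalSpace.Closeds K := fun n =>
    ⟨(fun x : K => (x : E3)) ⁻¹' (ω n)ᶜ, (hS n).2.1.isClosed_compl.preimage continuous_subtype_val⟩
  obtain ⟨F, s, hs, hF⟩ := CompactSpace.tendsto_subseq C
  let ω' : Set E3 := ((fun x : K => (x : E3)) '' (F : Set K) ∪ Kᶜ)ᶜ
  have hC : ∀ n, (ω n)ᶜ = (fun x : K => (x : E3)) '' (C n : Set K) ∪ Kᶜ := fun n => by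
    ext x
    have hsub : x ∈ ω n → x ∈ K := fun hx => hρ ((hS n).1 hx)
    simp only [C, TopologicalSpace.Closeds.coe_mk, Subtype.image_preimage_coe, Set.mem_union,
      Set.mem_inter_iff, Set.mem_compl_iff]
    tauto
  have hconv : HausdorffConv (fun k => ω (s k)) ω' := by
    have h0 : Tendsto (fun k => edist (C (s k)) F) atTop (𝓝 0) := by
      have := hF.edist (tendsto_const_nhds (x := F))
      rwa [edist_self] at this
    refine tendsto_of_tendsto_of_tendsto_of_le_of_le tendsto_const_nhds h0 (fun _ => zero_le)
      fun k => ?_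
    simp only [ω', compl_compl, hC]
    refine Metric.hausdorffEDist_union_le.trans ?_
    rw [Metric.hausdorffEDist_self, Metric.hausdorffEDist_image isometry_subtype_coe,
      TopologicalSpace.Closeds.edist_eq]
    simp
  have hsub : ω' ⊆ B := by
    intro x hx
    by_contra hxB
    have hxK : x ∈ K := by
      by_contra hxK
      exact hx (Or.inr hxK)
    -- A point of `K` outside `B` lies in every `C (s k)`, hence in their Hausdorff limit `F`.
    refine hx (Or.inl ⟨⟨x, hxK⟩, ?_, rfl⟩)
    have hcl : IsClosed (F : Set K) := F.isClosed
    rw [SetLike.mem_coe, ← SetLike.mem_coe, ← hcl.closure_eq, Metric.mem_closure_iff]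
    intro ε hε
    have h0 : Tendsto (fun k => edist (C (s k)) F) atTop (𝓝 0) := by
      have := hF.edist (tendsto_const_nhds (x := F))
      rwa [edist_self] at this
    obtain ⟨k, hk⟩ := (h0.eventually_lt_const (ENNReal.ofReal_pos.2 hε)).exists
    rw [TopologicalSpace.Closeds.edist_eq] at hk
    obtain ⟨z, hz, hz'⟩ := Metric.exists_edist_lt_of_hausdorffEDist_lt
      (x := (⟨x, hxK⟩ : K)) (show (⟨x, hxK⟩ : K) ∈ (C (s k) : Set K) from
        fun hx' => hxB ((hS _).1 hx')) hk
    exact ⟨z, hz, by rwa [edist_dist, ENNReal.ofReal_lt_ofReal_iff hε] at hz'⟩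
  have hopen : IsOpen ω' := by
    -- Since `Kᶜ` is not closed, openness of `ω'` is not visible from its definition; knowing `ω' ⊆
    -- B ⊆ K`, the set `Kᶜ` can be dropped.
    have : ω' = B ∩ ((fun x : K => (x : E3)) '' (F : Set K))ᶜ := by
      ext x
      constructor
      · exact fun hx => ⟨hsub hx, fun h' => hx (Or.inl h')⟩
      · rintro ⟨h1, h2⟩ (h3 | h3)
        · exact h2 h3
        · exact h3 (hρ h1)
    rw [this]
    refine hBo.inter (isOpen_compl_iff.2 ?_)
    exact Metric.isClosed_closedBall.isClosedMap_subtype_val _ F.isClosed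
  exact ⟨s, hs, ω', ⟨hsub, hopen, fun x hx =>
    isGraphNear_of_mem_frontier hopen hconv (fun n => (hS (s n)).2.2) hx⟩, hconv⟩

/-! ### The regularized maximum and the penalty law -/

/-- Naming the half-width `a` with `γ * a = 1 / 2` makes most later estimates linear. Both junction
points may be counted with the middle piece, since the pieces agree there. -/
lemma regMax_cases {γ : ℝ} (hγ : 0 < γ) (x : ℝ) : ∃ a : ℝ, a = 1 / (2 * γ) ∧ 0 < a ∧ γ * a = 1 / 2 ∧
    ((a ≤ x - 1 ∧ regMax γ x = x) ∨
      ((-a ≤ x - 1 ∧ x - 1 ≤ a) ∧ regMax γ x = 1 + γ / 2 * (x - 1 + a) ^ 2) ∨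
      (x - 1 ≤ -a ∧ regMax γ x = 1)) := by
  refine ⟨1 / (2 * γ), rfl, by positivity, by field_simp, ?_⟩
  unfold regMax
  split_ifs with h1 h2
  · exact Or.inl ⟨h1, rfl⟩
  · exact Or.inr (Or.inl ⟨abs_le.1 h2, rfl⟩)
  · refine Or.inr (Or.inr ⟨?_, rfl⟩)
    by_contra h3
    exact h2 (abs_le.2 ⟨(not_le.1 h3).le, (not_le.1 h1).le⟩)

lemma one_le_regMax {γ : ℝ} (hγ : 0 < γ) (x : ℝ) : 1 ≤ regMax γ x := by
  obtain ⟨a, -, ha, hγa, ⟨h, e⟩ | ⟨h, e⟩ | ⟨h, e⟩⟩ := regMax_cases hγ x <;> rw [e]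
  · linarith
  · have : 0 ≤ γ / 2 * (x - 1 + a) ^ 2 := by positivity
    linarith

lemma le_regMax {γ : ℝ} (hγ : 0 < γ) (x : ℝ) : x ≤ regMax γ x := by
  obtain ⟨a, -, ha, hγa, ⟨h, e⟩ | ⟨h, e⟩ | ⟨h, e⟩⟩ := regMax_cases hγ x <;> rw [e]
  -- On the middle piece `regMax γ x - x` equals this square: the parabola touches the diagonal at
  -- the upper junction.
  · have h1 : 0 ≤ γ / 2 * (x - 1 - a) ^ 2 := by positivity
    have h2 : γ / 2 * (x - 1 + a) ^ 2 = γ / 2 * (x - 1 - a) ^ 2 + 2 * (γ * a) * (x - 1) := by ring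
    rw [h2, hγa]
    linarith
  · linarith

lemma regMax_sub_le {γ : ℝ} (hγ : 0 < γ) {x : ℝ} (hx : 0 ≤ x) :
    regMax γ x - x ≤ 1 + 1 / (2 * γ) := by
  obtain ⟨a, ha', ha, hγa, ⟨h, e⟩ | ⟨h, e⟩ | ⟨h, e⟩⟩ := regMax_cases hγ x <;> rw [e, ← ha']
  · linarith
  · have h3 : (x - 1 + a) ^ 2 ≤ (2 * a) ^ 2 := pow_le_pow_left₀ (by linarith) (by linarith) 2
    have h4 : γ / 2 * (x - 1 + a) ^ 2 ≤ γ / 2 * (2 * a) ^ 2 := by gcongr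
    have h5 : γ / 2 * (2 * a) ^ 2 = 2 * (γ * a) * a := by ring
    rw [h5, hγa] at h4
    linarith
  · linarith

/-- The slope of the parabola, `γ * (x - 1 + a)`, grows from `0` at the lower junction to `2 * γ * a
= 1` at the upper one. Pairs on different pieces are compared through the junction values. -/
lemma regMax_mono_lip {γ : ℝ} (hγ : 0 < γ) {x y : ℝ} (hxy : x ≤ y) :
    0 ≤ regMax γ y - regMax γ x ∧ regMax γ y - regMax γ x ≤ y - x := by
  obtain ⟨a, ha', ha, hγa, hx⟩ := regMax_cases hγ x
  obtain ⟨b, hb', -, -, hy⟩ := regMax_cases hγ y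
  obtain rfl : b = a := hb'.trans ha'.symm
  -- the parabola lies between its tangents at the two junction points
  have par : ∀ s t : ℝ, 0 ≤ s → s ≤ t → t ≤ 2 * b →
      0 ≤ γ / 2 * t ^ 2 - γ / 2 * s ^ 2 ∧ γ / 2 * t ^ 2 - γ / 2 * s ^ 2 ≤ t - s := by
    intro s t h1 h2 h3
    have e1 : γ / 2 * t ^ 2 - γ / 2 * s ^ 2 = γ * ((t + s) / 2) * (t - s) := by ring
    have e2 : γ * ((t + s) / 2) ≤ γ * (2 * b) := by gcongr; linarith
    have e3 : γ * (2 * b) = 1 := by linarith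
    rw [e1]
    refine ⟨mul_nonneg (mul_nonneg hγ.le (by linarith)) (by linarith), ?_⟩
    calc _ ≤ 1 * (t - s) := mul_le_mul_of_nonneg_right (e2.trans e3.le) (by linarith)
      _ = t - s := one_mul _
  -- The parabolic piece ends at height `1 + b`, where the linear piece starts.
  have e4 : γ / 2 * (2 * b) ^ 2 = b := by
    have : γ / 2 * (2 * b) ^ 2 = 2 * (γ * b) * b := by ring
    rw [this, hγa]; ring
  rcases hx with ⟨h1, e⟩ | ⟨h1, e⟩ | ⟨h1, e⟩ <;> rcases hy with ⟨h2, e'⟩ | ⟨h2, e'⟩ | ⟨h2, e'⟩ <;>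
    rw [e, e']
  · constructor <;> linarith
  · have := par (2 * b) (y - 1 + b) (by linarith) (by linarith) (by linarith)
    constructor <;> linarith
  · constructor <;> linarith
  · have := par (x - 1 + b) (2 * b) (by linarith) (by linarith) (by linarith)
    constructor <;> linarith
  · have := par (x - 1 + b) (y - 1 + b) (by linarith) (by linarith) (by linarith)
    constructor <;> linarith
  · have := par 0 (x - 1 + b) (by linarith) (by linarith) (by linarith)
    constructor <;> linarith
  · constructor <;> linarith
  · have := par 0 (y - 1 + b) (by linarith) (by linarith) (by linarith)
    constructor <;> linarith
  · constructor <;> linarith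

/-- This says that `x / regMax γ x` is nondecreasing for `x ≥ 0`, i.e. that the modulus of the
penalty law grows with the modulus of the field. -/
lemma mul_regMax_le {γ : ℝ} (hγ : 0 < γ) {x y : ℝ} (hx : 0 ≤ x) (hxy : x ≤ y) :
    x * regMax γ y ≤ y * regMax γ x := by
  have hlin := le_regMax hγ x
  have hx1 := one_le_regMax hγ x
  have hmono := (regMax_mono_lip hγ hxy).1
  obtain ⟨a, ha', ha, hγa, hx'⟩ := regMax_cases hγ x
  obtain ⟨b, hb', -, -, hy⟩ := regMax_cases hγ y
  obtain rfl : b = a := hb'.trans ha'.symm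
  rcases hy with ⟨h2, e'⟩ | ⟨h2, e'⟩ | ⟨h2, e'⟩
  · rw [e', mul_comm]
    exact mul_le_mul_of_nonneg_left hlin (by linarith)
  · rcases hx' with ⟨h1, e⟩ | ⟨h1, e⟩ | ⟨h1, e⟩
    · obtain rfl : x = y := by linarith
      exact le_rfl
    · rw [e, e']
      -- On the parabola the difference of the two sides factors as in `p4`. The second factor is
      -- nonnegative because `(1 + b)² - (1 - b)² = 4 * b` and `γ * b = 1 / 2`.
      have p1 : x * y ≤ (1 + b) * (1 + b) :=
        mul_le_mul (by linarith) (by linarith) (by linarith) (by linarith)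
      have p2 : γ / 2 * (x * y - (1 - b) ^ 2) ≤ γ / 2 * (4 * b) :=
        mul_le_mul_of_nonneg_left (by nlinarith) (by positivity)
      have p3 : γ / 2 * (4 * b) = 1 := by linarith
      have p4 : y * (1 + γ / 2 * (x - 1 + b) ^ 2) - x * (1 + γ / 2 * (y - 1 + b) ^ 2) =
          (y - x) * (1 - γ / 2 * (x * y - (1 - b) ^ 2)) := by ring
      have p5 := mul_nonneg (sub_nonneg.2 hxy)
        (show 0 ≤ 1 - γ / 2 * (x * y - (1 - b) ^ 2) by linarith)
      linarith
    · rw [e, e']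
      have q1 : γ / 2 * (y - 1 + b) * (y - 1 + b) ≤ γ / 2 * (2 * b) * (y - 1 + b) := by
        gcongr
        · linarith
        · linarith
      have q2 : γ / 2 * (2 * b) = 1 / 2 := by linarith
      have q3 : x * (γ / 2 * (y - 1 + b) ^ 2) ≤ x * (1 / 2 * (y - 1 + b)) := by
        apply mul_le_mul_of_nonneg_left _ hx
        rw [← q2]; linarith
      nlinarith
  · rw [e']
    nlinarith

/-- The penalty law `x ↦ j γ x / max_γ {1, γ |x|}`. -/
noncomputable def penLaw (j γ : ℝ) (x : E3) : E3 := (j * γ / regMax γ (γ * ‖x‖)) • x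

lemma penLaw_zero (j γ : ℝ) : penLaw j γ 0 = 0 := by simp [penLaw]

lemma norm_penLaw_le {j γ : ℝ} (hj : 0 < j) (hγ : 0 < γ) (x : E3) : ‖penLaw j γ x‖ ≤ j := by
  have h1 := one_le_regMax hγ (γ * ‖x‖)
  have h2 := le_regMax hγ (γ * ‖x‖)
  rw [penLaw, norm_smul, Real.norm_of_nonneg (by positivity), div_mul_eq_mul_div,
    div_le_iff₀ (by linarith)]
  nlinarith

lemma inner_penLaw_nonneg {j γ : ℝ} (hj : 0 < j) (hγ : 0 < γ) (x : E3) :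
    0 ≤ inner ℝ (penLaw j γ x) x := by
  have h1 := one_le_regMax hγ (γ * ‖x‖)
  rw [penLaw, real_inner_smul_left]
  exact mul_nonneg (by positivity) real_inner_self_nonneg

/-- With `u = γ * ‖x‖` and `M = regMax γ u`, the defect of alignment is `j / γ * (M - u) * (u / M)`;
the middle factor is at most `1 + 1 / (2 * γ)` and the last at most `1`. This is the source of the
penalization error. -/
lemma sub_inner_penLaw_le {j γ : ℝ} (hj : 0 < j) (hγ : 0 < γ) (x : E3) :
    j * ‖x‖ - inner ℝ (penLaw j γ x) x ≤ j / γ * (1 + 1 / (2 * γ)) := by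
  have hu : 0 ≤ γ * ‖x‖ := by positivity
  have h1 := one_le_regMax hγ (γ * ‖x‖)
  have h2 := le_regMax hγ (γ * ‖x‖)
  have h3 := regMax_sub_le hγ hu
  rw [penLaw, real_inner_smul_left, real_inner_self_eq_norm_sq]
  set M := regMax γ (γ * ‖x‖)
  have hM : 0 < M := by linarith
  have e : j * ‖x‖ - j * γ / M * ‖x‖ ^ 2 = j / γ * ((M - γ * ‖x‖) * (γ * ‖x‖ / M)) := by
    field_simp
  rw [e]
  have h4 : γ * ‖x‖ / M ≤ 1 := (div_le_one hM).2 h2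
  refine mul_le_mul_of_nonneg_left ?_ (by positivity)
  calc _ ≤ (M - γ * ‖x‖) * 1 := mul_le_mul_of_nonneg_left h4 (by linarith)
    _ ≤ _ := by linarith

/-- The law keeps directions and has nondecreasing modulus. With coefficients `α`, `β` at `x`, `y`,
Cauchy–Schwarz bounds the product below by `(β‖y‖ - α‖x‖)(‖y‖ - ‖x‖)`. -/
lemma inner_penLaw_sub_nonneg {j γ : ℝ} (hj : 0 < j) (hγ : 0 < γ) (x y : E3) :
    0 ≤ inner ℝ (penLaw j γ x - penLaw j γ y) (x - y) := by
  wlog hxy : ‖x‖ ≤ ‖y‖ generalizing x y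
  · have := this y x (le_of_not_ge hxy)
    rwa [← neg_sub x y, ← neg_sub (penLaw j γ x), inner_neg_neg] at this
  have hm := mul_regMax_le hγ (x := γ * ‖x‖) (y := γ * ‖y‖) (by positivity) (by gcongr)
  have hl := (regMax_mono_lip hγ (x := γ * ‖x‖) (y := γ * ‖y‖) (by gcongr)).1
  have h1 := one_le_regMax hγ (γ * ‖x‖)
  have h2 := one_le_regMax hγ (γ * ‖y‖)
  unfold penLaw
  set M := regMax γ (γ * ‖x‖)
  set N := regMax γ (γ * ‖y‖)
  have hM : 0 < M := by linarith
  have hN : 0 < N := by linarith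
  have c1 : 0 ≤ j * γ / M := by positivity
  have c2 : 0 ≤ j * γ / N := by positivity
  have c3 : j * γ / M * ‖x‖ ≤ j * γ / N * ‖y‖ := by
    rw [div_mul_eq_mul_div, div_mul_eq_mul_div, div_le_div_iff₀ hM hN]
    nlinarith
  have hin := real_inner_le_norm x y
  have e : inner ℝ ((j * γ / M) • x - (j * γ / N) • y) (x - y) =
      j * γ / M * ‖x‖ ^ 2 + j * γ / N * ‖y‖ ^ 2 - (j * γ / M + j * γ / N) * inner ℝ x y := by
    simp only [inner_sub_left, inner_sub_right, real_inner_smul_left, real_inner_self_eq_norm_sq,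
      real_inner_comm x y]
    ring
  rw [e]
  have h5 := mul_le_mul_of_nonneg_left hin (add_nonneg c1 c2)
  have h6 := mul_nonneg (sub_nonneg.2 c3) (sub_nonneg.2 hxy)
  nlinarith

/-- One `j * γ` comes from moving the vector at fixed coefficient, the other from moving the
coefficient, using that `regMax` is 1-Lipschitz and dominates `γ * ‖y‖`. The constant blows up with
`γ`, but it serves only existence at fixed `γ`. -/
lemma norm_penLaw_sub_le {j γ : ℝ} (hj : 0 < j) (hγ : 0 < γ) (x y : E3) :
    ‖penLaw j γ x - penLaw j γ y‖ ≤ 2 * j * γ * ‖x - y‖ := by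
  have h1 := one_le_regMax hγ (γ * ‖x‖)
  have h2 := one_le_regMax hγ (γ * ‖y‖)
  have h3 := le_regMax hγ (γ * ‖y‖)
  have hlip : |regMax γ (γ * ‖y‖) - regMax γ (γ * ‖x‖)| ≤ γ * ‖x - y‖ := by
    have hn : |γ * ‖x‖ - γ * ‖y‖| ≤ γ * ‖x - y‖ := by
      rw [← mul_sub, abs_mul, abs_of_pos hγ]
      exact mul_le_mul_of_nonneg_left (abs_norm_sub_norm_le x y) hγ.le
    obtain ⟨n1, n2⟩ := abs_le.1 hn
    rcases le_total (γ * ‖x‖) (γ * ‖y‖) with h | h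
    · obtain ⟨a1, a2⟩ := regMax_mono_lip hγ h
      exact abs_le.2 ⟨by linarith, by linarith⟩
    · obtain ⟨a1, a2⟩ := regMax_mono_lip hγ h
      exact abs_le.2 ⟨by linarith, by linarith⟩
  unfold penLaw
  set M := regMax γ (γ * ‖x‖)
  set N := regMax γ (γ * ‖y‖)
  have hM : 0 < M := by linarith
  have hN : 0 < N := by linarith
  have e : (j * γ / M) • x - (j * γ / N) • y =
      (j * γ / M) • (x - y) + (j * γ * (N - M) / (M * N)) • y := by
    rw [smul_sub, sub_add, ← sub_smul]
    congr 2
    field_simp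
    ring
  rw [e]
  refine (norm_add_le _ _).trans ?_
  rw [norm_smul, norm_smul, Real.norm_of_nonneg (by positivity), Real.norm_eq_abs, abs_div, abs_mul,
    abs_of_pos (mul_pos hj hγ), abs_of_pos (mul_pos hM hN)]
  have b1 : j * γ / M * ‖x - y‖ ≤ j * γ * ‖x - y‖ := by
    gcongr
    exact div_le_self (by positivity) h1
  have b2 : j * γ * |N - M| / (M * N) * ‖y‖ ≤ j * γ * ‖x - y‖ := by
    rw [div_mul_eq_mul_div, div_le_iff₀ (by positivity)]
    calc j * γ * |N - M| * ‖y‖ ≤ j * γ * (γ * ‖x - y‖) * ‖y‖ := by gcongr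
      _ = j * γ * ‖x - y‖ * (1 * (γ * ‖y‖)) := by ring
      _ ≤ j * γ * ‖x - y‖ * (M * N) := by gcongr
  linarith

/-! ### Multiplication operators and cut-offs on `L²` -/

lemma measure_restrict_le {Ω S : Set E3} (hS : S ⊆ Ω) :
    (volume.restrict S : Measure E3) ≤ volume.restrict Ω :=
  Measure.restrict_mono hS le_rfl

lemma ae_restrict_of_subset {Ω S : Set E3} (hS : S ⊆ Ω) {P : E3 → Prop}
    (h : ∀ᵐ x ∂volume.restrict Ω, P x) : ∀ᵐ x ∂volume.restrict S, P x :=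
  ae_mono (measure_restrict_le hS) h

lemma toEuclideanLin_eq_sum (M : Matrix (Fin 3) (Fin 3) ℝ) (ξ : E3) :
    Matrix.toEuclideanLin M ξ =
      ∑ i, ∑ j, (M i j * ξ j) • (EuclideanSpace.single i (1 : ℝ) : E3) := by
  ext k
  fin_cases k <;> simp [Matrix.toEuclideanLin, Matrix.mulVec, dotProduct, Fin.sum_univ_three]

/-- Pointwise multiplication by an essentially bounded matrix field. -/
theorem exists_matrix_mul {Ω : Set E3} {M : E3 → Matrix (Fin 3) (Fin 3) ℝ}
    (hM : ∀ i j, MemLp (fun x => M x i j) ∞ (volume.restrict Ω)) :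
    ∃ A : L2 Ω →L[ℝ] L2 Ω, ∀ p : L2 Ω,
      A p =ᵐ[volume.restrict Ω] fun x => Matrix.toEuclideanLin (M x) (p x) := by
  have hcoord : ∀ (p : E3 → E3), MemLp p 2 (volume.restrict Ω) → ∀ i j,
      MemLp (fun x => M x i j * p x j) 2 (volume.restrict Ω) := by
    intro p hp i j
    have h1 : MemLp (fun x => p x j) 2 (volume.restrict Ω) :=
      (EuclideanSpace.proj j : E3 →L[ℝ] ℝ).comp_memLp' hp
    exact h1.mul (hM i j)
  have hmem : ∀ (p : E3 → E3), MemLp p 2 (volume.restrict Ω) →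
      MemLp (fun x => Matrix.toEuclideanLin (M x) (p x)) 2 (volume.restrict Ω) := by
    intro p hp
    simp only [toEuclideanLin_eq_sum]
    refine memLp_finsetSum _ fun i _ => memLp_finsetSum _ fun j _ => ?_
    exact (ContinuousLinearMap.toSpanSingleton ℝ
      (EuclideanSpace.single i (1 : ℝ) : E3)).comp_memLp' (hcoord p hp i j)
  have hbd : ∃ C : ℝ, 0 ≤ C ∧ ∀ᵐ x ∂volume.restrict Ω, ∀ ξ : E3,
      ‖Matrix.toEuclideanLin (M x) ξ‖ ≤ C * ‖ξ‖ := by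
    have h1 : ∀ i j, ∀ᵐ x ∂volume.restrict Ω,
        ‖M x i j‖ ≤ (eLpNorm (fun x => M x i j) ∞ (volume.restrict Ω)).toReal := by
      intro i j
      filter_upwards [ae_le_eLpNormEssSup (f := fun x => M x i j) (μ := volume.restrict Ω)]
        with x hx
      have := (hM i j).eLpNorm_ne_top
      rw [eLpNorm_exponent_top] at this ⊢
      have h2 := ENNReal.toReal_mono this hx
      simpa using h2
    refine ⟨∑ i : Fin 3, ∑ j : Fin 3, (eLpNorm (fun x => M x i j) ∞ (volume.restrict Ω)).toReal,
      by positivity, ?_⟩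
    filter_upwards [ae_all_iff.2 fun i => ae_all_iff.2 fun j => h1 i j] with x hx ξ
    rw [toEuclideanLin_eq_sum, Finset.sum_mul]
    refine (norm_sum_le _ _).trans (Finset.sum_le_sum fun i _ => ?_)
    rw [Finset.sum_mul]
    refine (norm_sum_le _ _).trans (Finset.sum_le_sum fun j _ => ?_)
    rw [norm_smul, PiLp.norm_single, norm_one, mul_one, norm_mul]
    exact mul_le_mul (hx i j) (PiLp.norm_apply_le ξ j) (norm_nonneg _) ENNReal.toReal_nonneg
  obtain ⟨C, hC, hbd⟩ := hbd
  refine ⟨LinearMap.mkContinuous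
    { toFun := fun p => (hmem p (Lp.memLp p)).toLp _
      map_add' := fun p q => by
        apply Lp.ext
        filter_upwards [(hmem _ (Lp.memLp (p + q))).coeFn_toLp, (hmem _ (Lp.memLp p)).coeFn_toLp,
          (hmem _ (Lp.memLp q)).coeFn_toLp, Lp.coeFn_add p q,
          Lp.coeFn_add ((hmem _ (Lp.memLp p)).toLp _) ((hmem _ (Lp.memLp q)).toLp _)]
          with x h1 h2 h3 h4 h5
        rw [h1, h5, Pi.add_apply, h2, h3, h4, Pi.add_apply, map_add]
      map_smul' := fun c p => by
        apply Lp.ext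
        filter_upwards [(hmem _ (Lp.memLp (c • p))).coeFn_toLp, (hmem _ (Lp.memLp p)).coeFn_toLp,
          Lp.coeFn_smul c p, Lp.coeFn_smul c ((hmem _ (Lp.memLp p)).toLp _)]
          with x h1 h2 h3 h4
        rw [h1, RingHom.id_apply, h4, Pi.smul_apply, h2, h3, Pi.smul_apply, map_smul] } C ?_, ?_⟩
  · intro p
    refine Lp.norm_le_mul_norm_of_ae_le_mul ?_
    filter_upwards [(hmem _ (Lp.memLp p)).coeFn_toLp, hbd] with x h1 h2
    simp only [LinearMap.coe_mk, AddHom.coe_mk]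
    rw [h1]
    exact h2 _
  · exact fun p => (hmem _ (Lp.memLp p)).coeFn_toLp

/-- Restriction of a field to a measurable set, extended by zero. -/
noncomputable def cut {Ω : Set E3} {S : Set E3} (hS : MeasurableSet S) : L2 Ω →L[ℝ] L2 Ω :=
  LinearMap.mkContinuous
    { toFun := fun p => ((Lp.memLp p).indicator hS).toLp _
      map_add' := fun p q => by
        apply Lp.ext
        filter_upwards [((Lp.memLp (p + q)).indicator hS).coeFn_toLp,
          ((Lp.memLp p).indicator hS).coeFn_toLp,
          ((Lp.memLp q).indicator hS).coeFn_toLp, Lp.coeFn_add p q,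
          Lp.coeFn_add (((Lp.memLp p).indicator hS).toLp _) (((Lp.memLp q).indicator hS).toLp _)]
          with x h1 h2 h3 h4 h5
        rw [h1, h5, Pi.add_apply, h2, h3]
        by_cases hx : x ∈ S
        · rw [Set.indicator_of_mem hx, Set.indicator_of_mem hx, Set.indicator_of_mem hx, h4,
            Pi.add_apply]
        · simp [hx]
      map_smul' := fun c p => by
        apply Lp.ext
        filter_upwards [((Lp.memLp (c • p)).indicator hS).coeFn_toLp,
          ((Lp.memLp p).indicator hS).coeFn_toLp,
          Lp.coeFn_smul c p, Lp.coeFn_smul c (((Lp.memLp p).indicator hS).toLp _)]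
          with x h1 h2 h3 h4
        rw [h1, RingHom.id_apply, h4, Pi.smul_apply, h2]
        by_cases hx : x ∈ S
        · rw [Set.indicator_of_mem hx, Set.indicator_of_mem hx, h3, Pi.smul_apply]
        · simp [hx] } 1 (fun p => by
    refine Lp.norm_le_mul_norm_of_ae_le_mul ?_
    filter_upwards [((Lp.memLp p).indicator hS).coeFn_toLp] with x h1
    simp only [LinearMap.coe_mk, AddHom.coe_mk]
    rw [h1, one_mul]
    exact norm_indicator_le_norm_self _ _)

lemma coeFn_cut {Ω S : Set E3} (hS : MeasurableSet S) (p : L2 Ω) :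
    cut hS p =ᵐ[volume.restrict Ω] S.indicator p :=
  ((Lp.memLp p).indicator hS).coeFn_toLp

lemma norm_cut_le {Ω S : Set E3} (hS : MeasurableSet S) (p : L2 Ω) : ‖cut hS p‖ ≤ ‖p‖ := by
  have := (cut (Ω := Ω) hS).le_of_opNorm_le
    (LinearMap.mkContinuous_norm_le _ zero_le_one _) p
  rwa [one_mul] at this

lemma setIntegral_inner_eq_cut {Ω S : Set E3} (hS : MeasurableSet S) (hSΩ : S ⊆ Ω) (p q : L2 Ω) :
    ∫ x in S, inner ℝ (p x) (q x) = inner ℝ (cut hS p) q := by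
  rw [L2.inner_def, ← Measure.restrict_restrict_of_subset hSΩ, ← integral_indicator hS]
  refine integral_congr_ae ?_
  filter_upwards [coeFn_cut hS p] with x hx
  rw [hx]
  by_cases h : x ∈ S <;> simp [h]

lemma integrableOn_norm {Ω S : Set E3} (hSΩ : S ⊆ Ω) (hΩ : volume Ω ≠ ∞) (p : L2 Ω) :
    IntegrableOn (fun x => ‖p x‖) S := by
  have : IsFiniteMeasure (volume.restrict S : Measure E3) :=
    isFiniteMeasure_restrict.2 (measure_ne_top_of_subset hSΩ hΩ)
  exact (((Lp.memLp p).mono_measure (measure_restrict_le hSΩ)).integrable (by norm_num)).norm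

lemma integrableOn_inner {Ω S : Set E3} (hSΩ : S ⊆ Ω) (p q : L2 Ω) :
    IntegrableOn (fun x => inner ℝ (p x) (q x)) S :=
  (L2.integrable_inner p q).mono_measure (measure_restrict_le hSΩ)

lemma setIntegral_norm_le {Ω S : Set E3} (hSΩ : S ⊆ Ω) (hΩ : volume Ω ≠ ∞) (p : L2 Ω) :
    ∫ x in S, ‖p x‖ ≤ ‖p‖ * √(volume S).toReal := by
  have hS : volume S ≠ ∞ := measure_ne_top_of_subset hSΩ hΩ
  have : IsFiniteMeasure (volume.restrict S : Measure E3) := isFiniteMeasure_restrict.2 hS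
  have hm : MemLp p 2 (volume.restrict S) := (Lp.memLp p).mono_measure (measure_restrict_le hSΩ)
  have h1 := eLpNorm_le_eLpNorm_mul_rpow_measure_univ (p := 1) (q := 2) (by norm_num)
    hm.aestronglyMeasurable
  have h2 : eLpNorm p 2 (volume.restrict S) ≤ eLpNorm p 2 (volume.restrict Ω) :=
    eLpNorm_mono_measure _ (measure_restrict_le hSΩ)
  have h3 := h1.trans (mul_le_mul_left h2 _)
  have h4 : eLpNorm p 2 (volume.restrict Ω) *
      (volume.restrict S) Set.univ ^ (1 / (1 : ℝ≥0∞).toReal - 1 / (2 : ℝ≥0∞).toReal) ≠ ∞ :=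
    ENNReal.mul_ne_top (Lp.eLpNorm_ne_top p)
      (ENNReal.rpow_ne_top_of_nonneg (by norm_num) (measure_ne_top _ _))
  have h5 := ENNReal.toReal_mono h4 h3
  rw [eLpNorm_one_eq_lintegral_enorm, ENNReal.toReal_mul, ← Lp.norm_def, ← ENNReal.toReal_rpow,
    Measure.restrict_apply_univ, ← integral_norm_eq_lintegral_enorm hm.aestronglyMeasurable] at h5
  rw [Real.sqrt_eq_rpow]
  convert h5 using 3
  norm_num

lemma setIntegral_norm_sub_le {Ω S S' : Set E3} (hSΩ : S ⊆ Ω) (hSΩ' : S' ⊆ Ω)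
    (hS' : MeasurableSet S') (hΩ : volume Ω ≠ ∞) (p : L2 Ω) :
    (∫ x in S, ‖p x‖) - ∫ x in S', ‖p x‖ ≤ ∫ x in symmDiff S S', ‖p x‖ := by
  have hu : symmDiff S S' ⊆ Ω := by
    rintro x (hx | hx)
    exacts [hSΩ hx.1, hSΩ' hx.1]
  have h1 := integral_inter_add_sdiff (s := S) hS' (integrableOn_norm hSΩ hΩ p)
  have h2 : ∫ x in S ∩ S', ‖p x‖ ≤ ∫ x in S', ‖p x‖ :=
    setIntegral_mono_set (integrableOn_norm hSΩ' hΩ p) (ae_of_all _ fun x => norm_nonneg _)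
      (Set.inter_subset_right.eventuallyLE)
  have h3 : ∫ x in S \ S', ‖p x‖ ≤ ∫ x in symmDiff S S', ‖p x‖ :=
    setIntegral_mono_set (integrableOn_norm hu hΩ p) (ae_of_all _ fun x => norm_nonneg _)
      (Set.subset_union_left.eventuallyLE)
  linarith

/-! ### The bilinear form -/

/-- The field of an element of `H₀(curl)`, as a continuous linear map. -/
noncomputable def fldL (Ω : Set E3) : H0curl Ω →L[ℝ] L2 Ω :=
  (WithLp.fstL 2 ℝ (L2 Ω) (L2 Ω)).comp (H0curl Ω).subtypeL

/-- The curl of an element of `H₀(curl)`, as a continuous linear map. -/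
noncomputable def rotL (Ω : Set E3) : H0curl Ω →L[ℝ] L2 Ω :=
  (WithLp.sndL 2 ℝ (L2 Ω) (L2 Ω)).comp (H0curl Ω).subtypeL

lemma fldL_apply {Ω : Set E3} (v : H0curl Ω) : fldL Ω v = fld v := rfl

lemma norm_sq_H0curl {Ω : Set E3} (v : H0curl Ω) : ‖v‖ ^ 2 = ‖fld v‖ ^ 2 + ‖rot v‖ ^ 2 :=
  WithLp.prod_norm_sq_eq_of_L2 (v : Pair Ω)

lemma norm_fld_le {Ω : Set E3} (v : H0curl Ω) : ‖fld v‖ ≤ ‖v‖ := by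
  refine le_of_sq_le_sq ?_ (norm_nonneg _)
  rw [norm_sq_H0curl]
  nlinarith [sq_nonneg ‖rot v‖]

lemma toDual_apply {Ω : Set E3} (lam : L2 Ω) (v : H0curl Ω) :
    toDual lam v = inner ℝ lam (fld v) := rfl

instance (Ω : Set E3) : CompleteSpace (H0curl Ω) :=
  (Submodule.isClosed_topologicalClosure (testPairs Ω)).completeSpace_coe

lemma IsMaterial.exists_op {Ω B : Set E3} {M : E3 → Matrix (Fin 3) (Fin 3) ℝ}
    (hM : IsMaterial Ω B M) : ∃ (A : L2 Ω →L[ℝ] L2 Ω) (c : ℝ), 0 < c ∧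
      (∀ p q : L2 Ω, ∫ x in Ω, inner ℝ (Matrix.toEuclideanLin (M x) (p x)) (q x) =
        inner ℝ (A p) q) ∧ ∀ p : L2 Ω, c * ‖p‖ ^ 2 ≤ inner ℝ (A p) p := by
  obtain ⟨A, hA⟩ := exists_matrix_mul hM.bounded
  obtain ⟨c, hc, hpos⟩ := hM.posDef
  refine ⟨A, c, hc, fun p q => ?_, fun p => ?_⟩
  · rw [L2.inner_def]
    refine integral_congr_ae ?_
    filter_upwards [hA p] with x hx
    rw [hx]
  · rw [← real_inner_self_eq_norm_sq, L2.inner_def, L2.inner_def, ← integral_const_mul]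
    refine integral_mono_ae ((L2.integrable_inner p p).const_mul c) (L2.integrable_inner _ _) ?_
    filter_upwards [hA p, hpos] with x hx hx'
    rw [hx, real_inner_self_eq_norm_sq, real_inner_comm]
    exact hx' _

namespace Data

variable {D : Data}

/-- The bilinear form is continuous and coercive on `H₀(curl)`. -/
theorem Admissible.exists_form (hD : D.Admissible) :
    ∃ (T : H0curl D.Ω →L[ℝ] H0curl D.Ω →L[ℝ] ℝ) (c : ℝ), 0 < c ∧
      (∀ v w, D.a v w = T v w) ∧ ∀ v, c * ‖v‖ ^ 2 ≤ T v v := by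
  obtain ⟨A, c, hc, hA, hAc⟩ := hD.reluctivity.exists_op
  obtain ⟨A', c', hc', hA', hAc'⟩ := hD.permittivity.exists_op
  refine ⟨(innerSL ℝ).bilinearComp (A.comp (rotL D.Ω)) (rotL D.Ω) +
    (innerSL ℝ).bilinearComp (A'.comp (fldL D.Ω)) (fldL D.Ω), min c c', lt_min hc hc', ?_, ?_⟩
  · intro v w
    rw [a, hA, hA']
    rfl
  · intro v
    change _ ≤ inner ℝ (A (rot v)) (rot v) + inner ℝ (A' (fld v)) (fld v)
    rw [norm_sq_H0curl]
    have h1 := hAc (rot v)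
    have h2 := hAc' (fld v)
    have h3 := mul_le_mul_of_nonneg_right (min_le_left c c') (sq_nonneg ‖rot v‖)
    have h4 := mul_le_mul_of_nonneg_right (min_le_right c c') (sq_nonneg ‖fld v‖)
    linarith

lemma Admissible.volume_ne_top (hD : D.Admissible) : volume D.Ω ≠ ∞ :=
  hD.domain.isBounded.measure_lt_top.ne

lemma Admissible.exists_load (hD : D.Admissible) :
    ∃ F : L2 D.Ω, ∀ v, D.load v = inner ℝ F (fld v) := by
  refine ⟨hD.source.toLp D.f, fun v => ?_⟩
  rw [L2.inner_def, load]
  refine integral_congr_ae ?_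
  filter_upwards [hD.source.coeFn_toLp] with x hx
  rw [hx]

end Data

/-! ### Existence for strongly monotone operators -/

/-- **Zarantonello's theorem**: a strongly monotone Lipschitz operator from a Hilbert space to its
dual has a zero. -/
theorem exists_zero_of_strongly_monotone {H : Type*} [NormedAddCommGroup H] [InnerProductSpace ℝ H]
    [CompleteSpace H] (N : H → H →L[ℝ] ℝ) {c K : ℝ} (hc : 0 < c)
    (hmono : ∀ u v, c * ‖u - v‖ ^ 2 ≤ N u (u - v) - N v (u - v))
    (hlip : ∀ u v, ‖N u - N v‖ ≤ K * ‖u - v‖) : ∃ u, N u = 0 := by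
  let G : H → H := fun u => (InnerProductSpace.toDual ℝ H).symm (N u)
  -- Enlarging the Lipschitz constant makes it positive and at least `c`, so that `q ≥ 0` below.
  set K' := max K c
  have hK' : 0 < K' := hc.trans_le (le_max_right _ _)
  have hG : ∀ u v, ‖G u - G v‖ ≤ K' * ‖u - v‖ := fun u v => by
    rw [← map_sub, LinearIsometryEquiv.norm_map]
    exact (hlip u v).trans (mul_le_mul_of_nonneg_right (le_max_left _ _) (norm_nonneg _))
  have hGm : ∀ u v, c * ‖u - v‖ ^ 2 ≤ inner ℝ (G u - G v) (u - v) := fun u v => by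
    rw [inner_sub_left, InnerProductSpace.toDual_symm_apply, InnerProductSpace.toDual_symm_apply]
    exact hmono u v
  -- This step size minimizes `1 - 2 * ρ * c + ρ² * K'²`, the bound for the squared contraction
  -- factor of `u ↦ u - ρ • G u`; the minimum is `q`.
  set ρ := c / K' ^ 2
  have hρ : 0 < ρ := by positivity
  set q := 1 - c ^ 2 / K' ^ 2
  have hq1 : q < 1 := sub_lt_self _ (by positivity)
  have hq0 : 0 ≤ q := by
    rw [sub_nonneg, div_le_one (by positivity)]
    exact pow_le_pow_left₀ hc.le (le_max_right _ _) 2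
  have hcontr : ContractingWith (Real.toNNReal √q) fun u => u - ρ • G u := by
    refine ⟨?_, LipschitzWith.of_dist_le_mul fun u v => ?_⟩
    · rw [Real.toNNReal_lt_one, Real.sqrt_lt' one_pos]
      simpa using hq1
    · rw [Real.coe_toNNReal _ (Real.sqrt_nonneg _), dist_eq_norm, dist_eq_norm]
      refine le_of_sq_le_sq ?_ (by positivity)
      rw [mul_pow, Real.sq_sqrt hq0]
      have e : u - ρ • G u - (v - ρ • G v) = (u - v) - ρ • (G u - G v) := by
        rw [smul_sub]; abel
      rw [e, norm_sub_sq_real, norm_smul, Real.norm_of_nonneg hρ.le, real_inner_smul_right,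
        real_inner_comm]
      have h1 := hGm u v
      have h2 : ‖G u - G v‖ ^ 2 ≤ (K' * ‖u - v‖) ^ 2 :=
        pow_le_pow_left₀ (norm_nonneg _) (hG u v) 2
      have h3 : (ρ * ‖G u - G v‖) ^ 2 ≤ ρ ^ 2 * (K' * ‖u - v‖) ^ 2 := by
        rw [mul_pow]; gcongr
      have h4 : ρ * (c * ‖u - v‖ ^ 2) ≤ ρ * inner ℝ (G u - G v) (u - v) := by gcongr
      have h5 : ρ ^ 2 * (K' * ‖u - v‖) ^ 2 = c ^ 2 / K' ^ 2 * ‖u - v‖ ^ 2 := by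
        simp only [ρ]; field_simp
      have h6 : ρ * (c * ‖u - v‖ ^ 2) = c ^ 2 / K' ^ 2 * ‖u - v‖ ^ 2 := by
        simp only [ρ]; field_simp
      simp only [q]
      linarith
  have : Nonempty H := ⟨0⟩
  have hfix := hcontr.fixedPoint_isFixedPt
  set u := ContractingWith.fixedPoint _ hcontr
  refine ⟨u, ?_⟩
  have h1 : u - ρ • G u = u := hfix
  rw [sub_eq_self, smul_eq_zero] at h1
  have h2 : G u = 0 := h1.resolve_left hρ.ne'
  simpa [G] using h2

lemma exists_norm_apply_le {H : Type*} [NormedAddCommGroup H] [NormedSpace ℝ H]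
    (T : H →L[ℝ] H →L[ℝ] ℝ) : ∃ K : ℝ, ∀ u, ‖T u‖ ≤ K * ‖u‖ :=
  ⟨‖T‖, T.le_opNorm⟩

lemma fld_sub {Ω : Set E3} (v w : H0curl Ω) : fld (v - w) = fld v - fld w := rfl

lemma fld_add {Ω : Set E3} (v w : H0curl Ω) : fld (v + w) = fld v + fld w := rfl

namespace Data

variable {D : Data}

/-! ### Approximate solutions of the variational inequality -/

/-- `E` solves the variational inequality for the shape `ω` up to an error `δ`. -/
def IsApproxState (D : Data) (ω : Set E3) (δ : ℝ) (E : H0curl D.Ω) : Prop :=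
  ∀ v : H0curl D.Ω, D.load (v - E) ≤ D.a E (v - E) + D.phi ω v - D.phi ω E + δ

lemma isApproxState_zero {ω : Set E3} {E : H0curl D.Ω} : D.IsApproxState ω 0 E ↔ D.IsState ω E := by
  simp [IsApproxState, IsState]

lemma load_neg (hD : D.Admissible) (v : H0curl D.Ω) : D.load (-v) = -D.load v := by
  obtain ⟨F, hF⟩ := hD.exists_load
  rw [hF, hF, ← fldL_apply, map_neg, inner_neg_right, fldL_apply]

/-- Stability of approximate solutions with respect to the shape. -/
theorem IsApproxState.norm_sub_sq_le (hD : D.Admissible) {c : ℝ}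
    (hc : ∀ v, c * ‖v‖ ^ 2 ≤ D.a v v) {ω₁ ω₂ : Set E3}
    (h₁ : ω₁ ⊆ D.Ω) (h₂ : ω₂ ⊆ D.Ω) (m₁ : MeasurableSet ω₁) (m₂ : MeasurableSet ω₂) {δ₁ δ₂ : ℝ}
    {E₁ E₂ : H0curl D.Ω} (H₁ : D.IsApproxState ω₁ δ₁ E₁) (H₂ : D.IsApproxState ω₂ δ₂ E₂) :
    c * ‖E₁ - E₂‖ ^ 2 ≤
      δ₁ + δ₂ + D.jc * ((‖E₁‖ + ‖E₂‖) * √(volume (symmDiff ω₁ ω₂)).toReal) := by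
  obtain ⟨T, -, -, hT, -⟩ := hD.exists_form
  have hu : symmDiff ω₁ ω₂ ⊆ D.Ω := by
    rintro x (hx | hx)
    exacts [h₁ hx.1, h₂ hx.1]
  have hbd : ∀ E : H0curl D.Ω, ∫ x in symmDiff ω₁ ω₂, ‖fld E x‖ ≤
      ‖E‖ * √(volume (symmDiff ω₁ ω₂)).toReal := fun E =>
    (setIntegral_norm_le hu hD.volume_ne_top (fld E)).trans
      (mul_le_mul_of_nonneg_right (norm_fld_le E) (Real.sqrt_nonneg _))
  -- Each inequality is tested with the other solution. In the sum the loads cancel, the forms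
  -- combine to `-a(E₁ - E₂, E₁ - E₂)`, and the nonsmooth terms survive only on the symmetric
  -- difference.
  have e1 := H₁ E₂
  have e2 := H₂ E₁
  have e3 : D.load (E₁ - E₂) = -D.load (E₂ - E₁) := by rw [← load_neg hD, neg_sub]
  have e4 : D.a (E₁ - E₂) (E₁ - E₂) = -(D.a E₁ (E₂ - E₁) + D.a E₂ (E₁ - E₂)) := by
    simp only [hT, map_sub, sub_apply]
    ring
  have e5 := hc (E₁ - E₂)
  have e6 := (setIntegral_norm_sub_le h₁ h₂ m₂ hD.volume_ne_top (fld E₂)).trans (hbd E₂)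
  have e7 := setIntegral_norm_sub_le h₂ h₁ m₁ hD.volume_ne_top (fld E₁)
  rw [symmDiff_comm] at e7
  replace e7 := e7.trans (hbd E₁)
  have e8 := mul_le_mul_of_nonneg_left (add_le_add e6 e7) hD.jc_pos.le
  simp only [phi] at e1 e2
  nlinarith

/-- Two exact solutions of the variational inequality coincide. -/
theorem IsState.unique (hD : D.Admissible) {ω : Set E3} (h : ω ⊆ D.Ω) (hm : MeasurableSet ω)
    {E₁ E₂ : H0curl D.Ω} (H₁ : D.IsState ω E₁) (H₂ : D.IsState ω E₂) : E₁ = E₂ := by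
  obtain ⟨T, c, hc, hT, hTc⟩ := hD.exists_form
  have := (isApproxState_zero.2 H₁).norm_sub_sq_le hD (c := c) (fun v => by rw [hT]; exact hTc v)
    h h hm hm (isApproxState_zero.2 H₂)
  simp only [symmDiff_self, Set.bot_eq_empty, measure_empty, ENNReal.toReal_zero, Real.sqrt_zero,
    mul_zero, add_zero] at this
  have h0 : ‖E₁ - E₂‖ ^ 2 ≤ 0 := by
    by_contra hcon
    exact absurd this (not_le.2 (mul_pos hc (not_le.1 hcon)))
  rw [← sub_eq_zero, ← norm_eq_zero]
  exact pow_eq_zero_iff two_ne_zero |>.1 (le_antisymm h0 (sq_nonneg _))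

/-- The equation with an almost aligned multiplier gives an approximate solution. -/
theorem isApproxState_of_multiplier (hD : D.Admissible) {ω : Set E3} (h : ω ⊆ D.Ω)
    {E : H0curl D.Ω} {lam : L2 D.Ω}
    (heq : ∀ v : H0curl D.Ω, D.a E v + ∫ x in ω, inner ℝ (lam x) (fld v x) = D.load v)
    (hbd : ∀ᵐ x ∂volume.restrict ω, ‖lam x‖ ≤ D.jc) {d : ℝ}
    (hal : ∀ᵐ x ∂volume.restrict ω, D.jc * ‖fld E x‖ - inner ℝ (lam x) (fld E x) ≤ d) :
    D.IsApproxState ω ((volume ω).toReal * d) E := by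
  intro v
  have hv := integrableOn_norm h hD.volume_ne_top (fld v)
  have hE := integrableOn_norm h hD.volume_ne_top (fld E)
  have hfin : IsFiniteMeasure (volume.restrict ω : Measure E3) :=
    isFiniteMeasure_restrict.2 (measure_ne_top_of_subset h hD.volume_ne_top)
  -- Pointwise, the bound on `lam` controls `lam · v` by `jc * |v|`, while almost alignment gives
  -- `-lam · E ≤ -jc * |E| + d`.
  have h1 : ∫ x in ω, inner ℝ (lam x) (fld (v - E) x) ≤
      ∫ x in ω, (D.jc * ‖fld v x‖ - D.jc * ‖fld E x‖ + d) := by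
    refine integral_mono_ae (integrableOn_inner h _ _)
      (((hv.const_mul _).sub (hE.const_mul _)).add (integrable_const d)) ?_
    have hsub : ∀ᵐ x ∂volume.restrict D.Ω, fld (v - E) x = fld v x - fld E x := by
      have := Lp.coeFn_sub (fld v) (fld E)
      filter_upwards [this] with x hx
      exact hx
    filter_upwards [ae_restrict_of_subset h hsub, hbd, hal] with x h1 h2 h3
    rw [h1, inner_sub_right]
    have h4 := real_inner_le_norm (lam x) (fld v x)
    have h5 := mul_le_mul_of_nonneg_right h2 (norm_nonneg (fld v x))
    linarith
  have hadd := integral_add ((hv.const_mul D.jc).sub (hE.const_mul D.jc)) (integrable_const d)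
  simp only [Pi.sub_apply] at hadd
  rw [hadd, integral_sub (hv.const_mul _) (hE.const_mul _), integral_const_mul, integral_const_mul,
    setIntegral_const, smul_eq_mul, Measure.real] at h1
  have h2 := heq (v - E)
  simp only [phi]
  linarith

lemma IsPenSol.law' {γ : ℝ} {ω : Set E3} {E : H0curl D.Ω} {lam : L2 D.Ω}
    (H : D.IsPenSol γ ω E lam) :
    ∀ᵐ x ∂volume.restrict ω, lam x = penLaw D.jc γ (fld E x) := H.law

lemma IsPenSol.isApproxState (hD : D.Admissible) {γ : ℝ} (hγ : 0 < γ) {ω : Set E3} (h : ω ⊆ D.Ω)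
    {E : H0curl D.Ω} {lam : L2 D.Ω} (H : D.IsPenSol γ ω E lam) :
    D.IsApproxState ω ((volume ω).toReal * (D.jc / γ * (1 + 1 / (2 * γ)))) E := by
  refine isApproxState_of_multiplier hD h H.eqn ?_ ?_
  · filter_upwards [H.law'] with x hx
    rw [hx]
    exact norm_penLaw_le hD.jc_pos hγ _
  · filter_upwards [H.law'] with x hx
    rw [hx]
    exact sub_inner_penLaw_le hD.jc_pos hγ _

/-- An a priori bound for the penalized states, uniform in the shape and in the parameter. -/
lemma exists_penSol_bound (hD : D.Admissible) : ∃ R : ℝ, 0 ≤ R ∧ ∀ (γ : ℝ), 0 < γ → ∀ ω ⊆ D.Ω,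
    ∀ E lam, D.IsPenSol γ ω E lam → ‖E‖ ≤ R := by
  obtain ⟨T, c, hc, hT, hTc⟩ := hD.exists_form
  obtain ⟨F, hF⟩ := hD.exists_load
  refine ⟨‖F‖ / c, by positivity, fun γ hγ ω h E lam H => ?_⟩
  -- Testing with `E` itself, the multiplier term is nonnegative and can be dropped, so neither `γ`
  -- nor `ω` enters the bound.
  have h1 := H.eqn E
  have h2 : 0 ≤ ∫ x in ω, inner ℝ (lam x) (fld E x) := by
    refine integral_nonneg_of_ae ?_
    filter_upwards [H.law'] with x hx
    rw [hx]
    exact inner_penLaw_nonneg hD.jc_pos hγ _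
  rw [hF, hT] at h1
  have h3 := (real_inner_le_norm F (fld E)).trans
    (mul_le_mul_of_nonneg_left (norm_fld_le E) (norm_nonneg F))
  have h4 := hTc E
  rw [le_div_iff₀ hc]
  rcases (norm_nonneg E).eq_or_lt with h0 | h0
  · rw [← h0]; simp
  · have : ‖E‖ * (‖E‖ * c) ≤ ‖E‖ * ‖F‖ := by nlinarith
    exact le_of_mul_le_mul_left this h0

/-- The penalized problem has a solution for every shape. -/
theorem exists_penSol (hD : D.Admissible) {γ : ℝ} (hγ : 0 < γ) {ω : Set E3} (h : ω ⊆ D.Ω)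
    (hm : MeasurableSet ω) : ∃ E lam, D.IsPenSol γ ω E lam := by
  obtain ⟨T, c, hc, hT, hTc⟩ := hD.exists_form
  obtain ⟨F, hF⟩ := hD.exists_load
  obtain ⟨K, hK⟩ := exists_norm_apply_le T
  have hlip : LipschitzWith (Real.toNNReal (2 * D.jc * γ)) (penLaw D.jc γ) := by
    refine LipschitzWith.of_dist_le_mul fun x y => ?_
    have := hD.jc_pos
    rw [dist_eq_norm, dist_eq_norm, Real.coe_toNNReal _ (by positivity)]
    exact norm_penLaw_sub_le hD.jc_pos hγ x y
  let P : L2 D.Ω → L2 D.Ω := fun p => cut hm (hlip.compLp (penLaw_zero _ _) p)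
  have hP : ∀ p, P p =ᵐ[volume.restrict D.Ω] ω.indicator fun x => penLaw D.jc γ (p x) := fun p => by
    filter_upwards [coeFn_cut hm (hlip.compLp (penLaw_zero _ _) p),
      hlip.coeFn_compLp (penLaw_zero _ _) p] with x h1 h2
    rw [h1]
    by_cases hx : x ∈ ω
    · rw [Set.indicator_of_mem hx, Set.indicator_of_mem hx, h2]
      rfl
    · simp [hx]
  have hPm : ∀ p q, 0 ≤ inner ℝ (P p - P q) (p - q) := fun p q => by
    rw [L2.inner_def]
    refine integral_nonneg_of_ae ?_
    filter_upwards [hP p, hP q, Lp.coeFn_sub (P p) (P q), Lp.coeFn_sub p q] with x h1 h2 h3 h4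
    rw [h3, h4, Pi.sub_apply, Pi.sub_apply, h1, h2]
    by_cases hx : x ∈ ω
    · rw [Set.indicator_of_mem hx, Set.indicator_of_mem hx]
      exact inner_penLaw_sub_nonneg hD.jc_pos hγ _ _
    · simp [hx]
  have hPl : ∀ p q, ‖P p - P q‖ ≤ Real.toNNReal (2 * D.jc * γ) * ‖p - q‖ := fun p q => by
    simp only [P]
    rw [← map_sub]
    exact (norm_cut_le hm _).trans (hlip.norm_compLp_sub_le (penLaw_zero _ _) p q)
  -- A zero of `N` is a penalized state. Strong monotonicity comes from the coercive form, the
  -- superposition operator `P` being monotone.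
  let N : H0curl D.Ω → H0curl D.Ω →L[ℝ] ℝ := fun u => T u + toDual (P (fld u)) - toDual F
  have hdual : ∀ p : L2 D.Ω, ‖toDual p‖ ≤ ‖p‖ := fun p =>
    ContinuousLinearMap.opNorm_le_bound _ (norm_nonneg _) fun v => by
      rw [toDual_apply]
      exact (norm_inner_le_norm _ _).trans
        (mul_le_mul_of_nonneg_left (norm_fld_le v) (norm_nonneg _))
  obtain ⟨E, hE⟩ := exists_zero_of_strongly_monotone N hc
    (K := K + Real.toNNReal (2 * D.jc * γ))
    (fun u v => by
      have h1 := hTc (u - v)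
      have h2 := hPm (fld u) (fld v)
      have e : N u (u - v) - N v (u - v) =
          T (u - v) (u - v) + inner ℝ (P (fld u) - P (fld v)) (fld (u - v)) := by
        simp only [N, sub_apply, add_apply, toDual_apply,
          inner_sub_left, map_sub, fld_sub, inner_sub_right]
        ring
      rw [e]
      exact h1.trans (le_add_of_nonneg_right h2))
    (fun u v => by
      have e : N u - N v = T (u - v) + toDual (P (fld u) - P (fld v)) := by
        ext w
        simp only [N, sub_apply, add_apply, toDual_apply,
          inner_sub_left, map_sub]
        ring
      rw [e, add_mul]
      refine (norm_add_le (T (u - v)) (toDual (P (fld u) - P (fld v)))).trans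
        (add_le_add (hK _) ?_)
      refine (hdual _).trans ((hPl _ _).trans ?_)
      exact mul_le_mul_of_nonneg_left (norm_fld_le (u - v)) NNReal.zero_le_coe)
  refine ⟨E, P (fld E), ?_, fun v => ?_, ?_⟩
  · rw [IsZeroExt, ae_restrict_iff' (hD.domain.isOpen.measurableSet.diff hm)]
    have := (ae_restrict_iff' hD.domain.isOpen.measurableSet).1 (hP (fld E))
    filter_upwards [this] with x hx hx'
    rw [hx hx'.1, Set.indicator_of_notMem hx'.2]
  · have h1 : N E v = 0 := by rw [hE]; rfl
    have h2 : cut hm (P (fld E)) = P (fld E) := by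
      apply Lp.ext
      filter_upwards [coeFn_cut hm (P (fld E)), hP (fld E)] with x hx hx'
      rw [hx]
      by_cases hxω : x ∈ ω
      · rw [Set.indicator_of_mem hxω]
      · rw [hx']
        simp [hxω]
    rw [setIntegral_inner_eq_cut hm h, h2, hT, hF]
    simp only [N, sub_apply, add_apply, toDual_apply] at h1
    linarith
  · have := ae_restrict_of_subset h (hP (fld E))
    filter_upwards [this, ae_restrict_mem hm] with x hx hx'
    rw [hx, Set.indicator_of_mem hx']
    rfl

end Data

/-! ### Separation by test fields and multipliers from Hahn–Banach -/

/-- Test fields separate the points of `L²(Ω; ℝ³)`. -/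
theorem eq_zero_of_forall_inner_fld {Ω : Set E3} (hΩ : IsOpen Ω) {p : L2 Ω}
    (h : ∀ v : H0curl Ω, inner ℝ p (fld v) = 0) : p = 0 := by
  apply Lp.ext
  have hint : LocallyIntegrableOn p Ω := by
    have hl : LocallyIntegrable p (volume.restrict Ω) :=
      (Lp.memLp p).locallyIntegrable (by norm_num)
    exact locallyIntegrableOn_of_locallyIntegrable_restrict hl
  have key := hΩ.ae_eq_zero_of_integral_contDiff_smul_eq_zero hint (μ := volume) (f := p) ?_
  · rw [EventuallyEq, ae_restrict_iff' hΩ.measurableSet]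
    have h0 := (ae_restrict_iff' hΩ.measurableSet).1 (Lp.coeFn_zero E3 2 (volume.restrict Ω))
    filter_upwards [key, h0] with x hx hx0 hxΩ
    rw [hx hxΩ, hx0 hxΩ]
    rfl
  · intro g hg hgc hgs
    have hz : ∀ x ∉ Ω, g x = 0 := fun x hx =>
      image_eq_zero_of_notMem_tsupport fun h' => hx (hgs h')
    rw [← setIntegral_eq_integral_of_forall_compl_eq_zero (s := Ω)
      (fun x hx => by rw [hz x hx, zero_smul])]
    have hgi : MemLp g 2 (volume.restrict Ω) := hg.continuous.memLp_of_hasCompactSupport hgc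
    have hInt : IntegrableOn (fun x => g x • p x) Ω :=
      memLp_one_iff_integrable.1 ((Lp.memLp p).smul hgi)
    -- The vector-valued integral is tested in each direction `ξ`, since `g • ξ` is then a test
    -- field.
    refine ext_inner_right ℝ fun ξ => ?_
    rw [inner_zero_left, real_inner_comm, ← integral_inner hInt]
    have ht : IsTest Ω fun x => g x • ξ :=
      ⟨hg.smul contDiff_const, hgc.smul_right,
        (closure_mono (Function.support_smul_subset_left g fun _ => ξ)).trans hgs⟩
    have m1 : MemLp (fun x => g x • ξ) 2 (volume.restrict Ω) :=
      ht.differentiable.continuous.memLp_of_hasCompactSupport ht.compact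
    have m2 : MemLp (curl fun x => g x • ξ) 2 (volume.restrict Ω) :=
      ht.continuous_curl.memLp_of_hasCompactSupport ht.hasCompactSupport_curl
    let v : H0curl Ω := ⟨WithLp.toLp 2 (m1.toLp _, m2.toLp _),
      Submodule.le_topologicalClosure _ ⟨_, ht, m1.coeFn_toLp, m2.coeFn_toLp⟩⟩
    have hv := h v
    rw [L2.inner_def] at hv
    rw [← hv]
    refine integral_congr_ae ?_
    have hfld : fld v =ᵐ[volume.restrict Ω] fun x => g x • ξ := m1.coeFn_toLp
    filter_upwards [hfld] with x hx
    rw [hx, real_inner_smul_right, real_inner_smul_right, real_inner_comm]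

lemma continuous_setIntegral_norm {Ω S : Set E3} (hSΩ : S ⊆ Ω) (hΩ : volume Ω ≠ ∞) :
    Continuous fun p : L2 Ω => ∫ x in S, ‖p x‖ := by
  have hadd : ∀ p q : L2 Ω, (∫ x in S, ‖p x‖) - ∫ x in S, ‖q x‖ ≤
      √(volume S).toReal * ‖p - q‖ := fun p q => by
    rw [← integral_sub (integrableOn_norm hSΩ hΩ p) (integrableOn_norm hSΩ hΩ q), mul_comm]
    refine le_trans ?_ (setIntegral_norm_le hSΩ hΩ (p - q))
    refine integral_mono_ae ((integrableOn_norm hSΩ hΩ p).sub (integrableOn_norm hSΩ hΩ q))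
      (integrableOn_norm hSΩ hΩ _) ?_
    filter_upwards [ae_restrict_of_subset hSΩ (Lp.coeFn_sub p q)] with x hx
    rw [hx]
    exact norm_sub_norm_le _ _
  refine (LipschitzWith.of_dist_le_mul (K := ⟨√(volume S).toReal, Real.sqrt_nonneg _⟩)
    fun p q => ?_).continuous
  rw [Real.dist_eq, dist_eq_norm]
  refine abs_le.2 ⟨?_, hadd p q⟩
  have := hadd q p
  rw [norm_sub_rev] at this
  change - (√(volume S).toReal * ‖p - q‖) ≤ _
  linarith

/-- Moves a functional from `H₀(curl)` to the range of the field map without using its injectivity.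
The section need not be continuous: the sublinear bound supplies the control. -/
lemma exists_section_range {V W : Type*} [AddCommGroup V] [Module ℝ V] [AddCommGroup W] [Module ℝ W]
    (f : V →ₗ[ℝ] W) : ∃ σ : LinearMap.range f →ₗ[ℝ] V, ∀ y, f (σ y) = y := by
  obtain ⟨σ, hσ⟩ := f.rangeRestrict.exists_rightInverse_of_surjective f.range_rangeRestrict
  exact ⟨σ, fun y => congrArg Subtype.val (LinearMap.congr_fun hσ y)⟩

/-- A functional on `L²` dominated by `j ∫_ω |·|` is given by a multiplier that is bounded by `j` and
vanishes off `ω`. -/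
theorem exists_multiplier {Ω ω : Set E3} (hω : ω ⊆ Ω) (hm : MeasurableSet ω) (hΩ : volume Ω ≠ ∞)
    {j : ℝ} (hj : 0 < j) (F : H0curl Ω →ₗ[ℝ] ℝ) (hF : ∀ v, F v ≤ j * ∫ x in ω, ‖fld v x‖) :
    ∃ lam : L2 Ω, (∀ v, F v = inner ℝ lam (fld v)) ∧ cut hm lam = lam ∧
      ∀ᵐ x ∂volume.restrict ω, ‖lam x‖ ≤ j := by
  have hNsmul : ∀ (c : ℝ), ∀ p : L2 Ω, ∫ x in ω, ‖(c • p) x‖ = |c| * ∫ x in ω, ‖p x‖ := by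
    intro c p
    rw [← integral_const_mul]
    refine integral_congr_ae ?_
    filter_upwards [ae_restrict_of_subset hω (Lp.coeFn_smul c p)] with x hx
    rw [hx, Pi.smul_apply, norm_smul, Real.norm_eq_abs]
  have hNadd : ∀ p q : L2 Ω, ∫ x in ω, ‖(p + q) x‖ ≤ (∫ x in ω, ‖p x‖) + ∫ x in ω, ‖q x‖ := by
    intro p q
    rw [← integral_add (integrableOn_norm hω hΩ p) (integrableOn_norm hω hΩ q)]
    refine integral_mono_ae (integrableOn_norm hω hΩ _)
      ((integrableOn_norm hω hΩ p).add (integrableOn_norm hω hΩ q)) ?_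
    filter_upwards [ae_restrict_of_subset hω (Lp.coeFn_add p q)] with x hx
    rw [hx]
    exact norm_add_le _ _
  let R : H0curl Ω →ₗ[ℝ] L2 Ω := (fldL Ω).toLinearMap
  obtain ⟨σ, hσ'⟩ : ∃ σ : LinearMap.range R →ₗ[ℝ] H0curl Ω, ∀ y, fld (σ y) = y :=
    exists_section_range R
  -- Hahn–Banach extends the functional from the fields of `H₀(curl)` to all of `L²`, keeping the
  -- domination by the seminorm `j ∫_ω |·|`.
  obtain ⟨G, hG, hGN⟩ := exists_extension_of_le_sublinear (⟨R.range, F.comp σ⟩ : L2 Ω →ₗ.[ℝ] ℝ)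
    (fun p => j * ∫ x in ω, ‖p x‖)
    (fun c hc p => by rw [hNsmul, abs_of_pos hc]; ring)
    (fun p q => by rw [← mul_add]; exact mul_le_mul_of_nonneg_left (hNadd p q) hj.le)
    (fun y => by
      refine (hF (σ y)).trans_eq ?_
      rw [hσ'])
  have hGF : ∀ v, F v = G (fld v) := by
    intro v
    -- The element picked by the section differs from `v` by one with zero field, on which the
    -- domination gives `F ≤ 0`. Applying this also to `-v` gives equality.
    have hle : ∀ v, G (fld v) - F v ≤ 0 := by
      intro v
      have h1 : G (fld v) = F (σ ⟨fld v, v, rfl⟩) := hG ⟨fld v, v, rfl⟩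
      rw [h1, ← map_sub]
      refine (hF _).trans_eq ?_
      have : fld (σ ⟨fld v, v, rfl⟩ - v) = 0 := by
        rw [fld_sub, hσ', sub_self]
      rw [this]
      have h0 := hNsmul 0 0
      rw [zero_smul, abs_zero, zero_mul] at h0
      rw [h0, mul_zero]
    have h1 := hle v
    have h2 := hle (-v)
    have h3 : fld (-v) = -fld v := rfl
    rw [h3, map_neg, map_neg] at h2
    linarith
  have hbound : ∀ p, ‖G p‖ ≤ (j * √(volume ω).toReal) * ‖p‖ := by
    intro p
    have hb : ∀ p, G p ≤ (j * √(volume ω).toReal) * ‖p‖ := fun p => by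
      refine (hGN p).trans ?_
      rw [mul_assoc, mul_comm √_]
      exact mul_le_mul_of_nonneg_left (setIntegral_norm_le hω hΩ p) hj.le
    rw [Real.norm_eq_abs]
    refine abs_le.2 ⟨?_, hb p⟩
    have := hb (-p)
    rw [map_neg, norm_neg] at this
    linarith
  set lam : L2 Ω := (InnerProductSpace.toDual ℝ (L2 Ω)).symm (G.mkContinuous _ hbound)
  have hlam : ∀ p, inner ℝ lam p = G p := fun p => by
    rw [InnerProductSpace.toDual_symm_apply]
    rfl
  have hcutsub : ∀ {S : Set E3} (hS : MeasurableSet S) (p : L2 Ω),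
      inner ℝ p (cut hS p) = ‖cut hS p‖ ^ 2 := by
    intro S hS p
    rw [← real_inner_self_eq_norm_sq, L2.inner_def, L2.inner_def]
    refine integral_congr_ae ?_
    filter_upwards [coeFn_cut hS p] with x hx
    rw [hx]
    by_cases h : x ∈ S <;> simp [h]
  refine ⟨lam, fun v => by rw [hlam, hGF], ?_, ?_⟩
  -- Testing with the part of `lam` off `ω`, where the seminorm vanishes, makes its squared norm
  -- nonpositive.
  · have h0 : cut hm.compl lam = 0 := by
      have h1 := hGN (cut hm.compl lam)
      have h2 : ∫ x in ω, ‖cut hm.compl lam x‖ = 0 := by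
        refine integral_eq_zero_of_ae ?_
        filter_upwards [ae_restrict_of_subset hω (coeFn_cut hm.compl lam), ae_restrict_mem hm]
          with x hx hxω
        rw [hx]
        simp [hxω]
      rw [h2, mul_zero, ← hlam, hcutsub] at h1
      rw [← norm_eq_zero]
      exact pow_eq_zero_iff two_ne_zero |>.1 (le_antisymm h1 (sq_nonneg _))
    apply Lp.ext
    have h1 := coeFn_cut hm.compl lam
    rw [h0] at h1
    filter_upwards [h1, coeFn_cut hm lam, Lp.coeFn_zero E3 2 (volume.restrict Ω)] with x h1 h2 h3
    rw [h2]
    by_cases hx : x ∈ ω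
    · rw [Set.indicator_of_mem hx]
    · rw [Set.indicator_of_mem (show x ∈ ωᶜ from hx), h3] at h1
      rw [Set.indicator_of_notMem hx, ← h1]
      rfl
  -- Testing with `lam` restricted to `S` gives `∫_S |lam|² ≤ j ∫_S |lam|`, although the integrand
  -- on the left is strictly larger on `S`; hence `S` is null.
  · let S : Set E3 := ω ∩ {x | j < ‖lam x‖}
    have hS : MeasurableSet S := hm.inter
      (measurableSet_lt measurable_const (Lp.stronglyMeasurable lam).norm.measurable)
    have hSω : S ⊆ ω := Set.inter_subset_left
    have hSΩ := hSω.trans hω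
    have h1 := hGN (cut hS lam)
    have h2 : ∫ x in ω, ‖cut hS lam x‖ = ∫ x in S, ‖lam x‖ := by
      have e1 : ∫ x in ω, ‖cut hS lam x‖ = ∫ x in ω, S.indicator (fun x => ‖lam x‖) x := by
        refine integral_congr_ae ?_
        filter_upwards [ae_restrict_of_subset hω (coeFn_cut hS lam)] with x hx
        rw [hx, norm_indicator_eq_indicator_norm]
      rw [e1, integral_indicator hS, Measure.restrict_restrict_of_subset hSω]
    have h3 : ∫ x in S, ‖lam x‖ ^ 2 = inner ℝ lam (cut hS lam) := by
      rw [real_inner_comm, ← setIntegral_inner_eq_cut hS hSΩ]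
      simp only [real_inner_self_eq_norm_sq]
    rw [h2, ← hlam, ← h3] at h1
    have i1 : IntegrableOn (fun x => ‖lam x‖) S := integrableOn_norm hSΩ hΩ lam
    have i2 : IntegrableOn (fun x => ‖lam x‖ ^ 2) S := by
      have := integrableOn_inner hSΩ lam lam
      simpa only [real_inner_self_eq_norm_sq] using this
    have hnn : 0 ≤ᵐ[volume.restrict S] fun x => ‖lam x‖ ^ 2 - j * ‖lam x‖ := by
      filter_upwards [ae_restrict_mem hS] with x hx
      have : j < ‖lam x‖ := hx.2
      simp only [Pi.zero_apply]
      nlinarith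
    have hz : ∫ x in S, (‖lam x‖ ^ 2 - j * ‖lam x‖) = 0 := by
      refine le_antisymm ?_ (integral_nonneg_of_ae hnn)
      rw [integral_sub i2 (i1.const_mul j), integral_const_mul]
      linarith
    have hae := (integral_eq_zero_iff_of_nonneg_ae hnn (i2.sub (i1.const_mul j))).1 hz
    have hae' := (ae_restrict_iff' hS).1 hae
    rw [ae_restrict_iff' hm]
    filter_upwards [hae'] with x hx hxω
    by_contra hcon
    have hxS : x ∈ S := ⟨hxω, not_le.1 hcon⟩
    have h5 := hx hxS
    have h6 : j < ‖lam x‖ := hxS.2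
    simp only [Pi.zero_apply] at h5
    nlinarith

lemma continuous_apply₂ {H : Type*} [NormedAddCommGroup H] [NormedSpace ℝ H]
    (T : H →L[ℝ] H →L[ℝ] ℝ) : Continuous fun p : H × H => T p.1 p.2 :=
  T.continuous₂

/-! ### Limits of penalized states, solvability and multipliers -/

namespace Data

variable {D : Data}

lemma continuous_phi (hD : D.Admissible) {ω : Set E3} (h : ω ⊆ D.Ω) : Continuous (D.phi ω) :=
  continuous_const.mul
    ((continuous_setIntegral_norm h hD.volume_ne_top).comp (fldL D.Ω).continuous)

lemma tendsto_penError (D : Data) {γ : ℕ → ℝ} (hγ : Tendsto γ atTop atTop) {V : ℕ → ℝ} {R : ℝ}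
    (hV : ∀ n, 0 ≤ V n ∧ V n ≤ R) :
    Tendsto (fun n => V n * (D.jc / γ n * (1 + 1 / (2 * γ n)))) atTop (𝓝 0) := by
  have h1 : Tendsto (fun n => D.jc / γ n) atTop (𝓝 0) := tendsto_const_nhds.div_atTop hγ
  have h2 : Tendsto (fun n => 1 / (2 * γ n)) atTop (𝓝 0) :=
    tendsto_const_nhds.div_atTop (hγ.const_mul_atTop two_pos)
  have h3 := h1.mul (h2.const_add 1)
  rw [zero_mul] at h3
  refine bdd_le_mul_tendsto_zero' R ?_ h3
  exact Eventually.of_forall fun n => abs_le.2 ⟨by linarith [hV n, (hV n).1.trans (hV n).2], (hV n).2⟩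

/-- Convergence of the penalized states along converging shapes. -/
theorem tendsto_penSol (hD : D.Admissible) {γ : ℕ → ℝ} (hγ : ∀ n, 0 < γ n)
    (hγ_lim : Tendsto γ atTop atTop) {ω : ℕ → Set E3} {ω' : Set E3} (hω : ∀ n, ω n ⊆ D.Ω)
    (hω' : ω' ⊆ D.Ω) (hm : ∀ n, MeasurableSet (ω n)) (hm' : MeasurableSet ω')
    (hconv : Tendsto (fun n => volume (symmDiff (ω n) ω')) atTop (𝓝 0))
    {E : ℕ → H0curl D.Ω} {lam : ℕ → L2 D.Ω} (hE : ∀ n, D.IsPenSol (γ n) (ω n) (E n) (lam n))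
    {E' : H0curl D.Ω} (hE' : D.IsState ω' E') : Tendsto E atTop (𝓝 E') := by
  obtain ⟨T, c, hc, hT, hTc⟩ := hD.exists_form
  obtain ⟨R, hR, hbd⟩ := exists_penSol_bound hD
  -- The penalized state, with its error of order `1/γ`, is compared directly with the exact state
  -- on the limit shape, whose error is `0`.
  have hcomp := fun n => ((hE n).isApproxState hD (hγ n) (hω n)).norm_sub_sq_le hD (c := c)
    (fun v => by rw [hT]; exact hTc v) (hω n) hω' (hm n) hm' (isApproxState_zero.2 hE')
  have herr := tendsto_penError D hγ_lim (V := fun n => (volume (ω n)).toReal)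
    (R := (volume D.Ω).toReal) fun n =>
      ⟨ENNReal.toReal_nonneg, ENNReal.toReal_mono hD.volume_ne_top (measure_mono (hω n))⟩
  have hsq : Tendsto (fun n => √(volume (symmDiff (ω n) ω')).toReal) atTop (𝓝 0) := by
    have h1 := (ENNReal.tendsto_toReal ENNReal.zero_ne_top).comp hconv
    have h2 := (Real.continuous_sqrt.tendsto _).comp h1
    simpa [Function.comp_def] using h2
  have hmain : Tendsto (fun n => c * ‖E n - E'‖ ^ 2) atTop (𝓝 0) := by
    have hub := (herr.add_const 0).add ((hsq.const_mul (R + ‖E'‖)).const_mul D.jc)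
    simp only [mul_zero, add_zero] at hub
    refine squeeze_zero (fun n => by positivity) (fun n => (hcomp n).trans ?_) hub
    rw [add_zero]
    have := hbd (γ n) (hγ n) (ω n) (hω n) (E n) (lam n) (hE n)
    have := hD.jc_pos
    gcongr
  rw [tendsto_iff_norm_sub_tendsto_zero]
  have h1 := hmain.const_mul c⁻¹
  rw [mul_zero] at h1
  have h2 := (Real.continuous_sqrt.tendsto _).comp h1
  rw [Real.sqrt_zero] at h2
  refine h2.congr fun n => ?_
  simp only [Function.comp_apply]
  rw [inv_mul_cancel_left₀ hc.ne', Real.sqrt_sq (norm_nonneg _)]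

/-- The variational inequality has a solution for every shape. -/
theorem exists_state (hD : D.Admissible) {ω : Set E3} (h : ω ⊆ D.Ω) (hm : MeasurableSet ω) :
    ∃ E, D.IsState ω E := by
  obtain ⟨T, c, hc, hT, hTc⟩ := hD.exists_form
  obtain ⟨F, hF⟩ := hD.exists_load
  -- The state is constructed as a limit of penalized states. On a fixed shape the symmetric
  -- difference is empty, so squared distances are controlled by the penalty errors alone and the
  -- sequence is Cauchy.
  let γ : ℕ → ℝ := fun n => (n : ℝ) + 1
  have hγ : ∀ n, 0 < γ n := fun n => by positivity
  have hγ_lim : Tendsto γ atTop atTop :=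
    tendsto_atTop_add_const_right _ _ tendsto_natCast_atTop_atTop
  choose E lam hE using fun n => exists_penSol hD (hγ n) h hm
  have happ := fun n => (hE n).isApproxState hD (hγ n) h
  set δ : ℕ → ℝ := fun n => (volume ω).toReal * (D.jc / γ n * (1 + 1 / (2 * γ n)))
  have hδ : Tendsto δ atTop (𝓝 0) := tendsto_penError D hγ_lim (V := fun _ => (volume ω).toReal)
    fun n => ⟨ENNReal.toReal_nonneg, le_rfl⟩
  have hcauchy : CauchySeq E := by
    rw [Metric.cauchySeq_iff]
    intro ε hε
    obtain ⟨n₀, hn₀⟩ := eventually_atTop.1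
      (hδ.eventually_lt_const (show 0 < c * ε ^ 2 / 2 by positivity))
    refine ⟨n₀, fun m hmn n hnn => ?_⟩
    have h1 := (happ m).norm_sub_sq_le hD (c := c) (fun v => by rw [hT]; exact hTc v)
      h h hm hm (happ n)
    simp only [symmDiff_self, Set.bot_eq_empty, measure_empty, ENNReal.toReal_zero, Real.sqrt_zero,
      mul_zero, add_zero] at h1
    have h2 := hn₀ m hmn
    have h3 := hn₀ n hnn
    rw [dist_eq_norm]
    refine lt_of_pow_lt_pow_left₀ 2 hε.le (lt_of_mul_lt_mul_left ?_ hc.le)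
    linarith
  obtain ⟨E', hE'⟩ := cauchySeq_tendsto_of_complete hcauchy
  refine ⟨E', fun v => ?_⟩
  have hsub : Tendsto (fun n => v - E n) atTop (𝓝 (v - E')) := tendsto_const_nhds.sub hE'
  have hload : Tendsto (fun n => D.load (v - E n)) atTop (𝓝 (D.load (v - E'))) := by
    simp only [hF]
    exact (tendsto_const_nhds (x := F)).inner (((fldL D.Ω).continuous.tendsto _).comp hsub)
  have hform : Tendsto (fun n => D.a (E n) (v - E n)) atTop (𝓝 (D.a E' (v - E'))) := by
    simp only [hT]
    exact ((continuous_apply₂ T).tendsto (E', v - E')).comp (hE'.prodMk_nhds hsub)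
  have hphi := ((continuous_phi hD h).tendsto E').comp hE'
  have hlim := ((hform.add_const (D.phi ω v)).sub hphi).add hδ
  rw [add_zero] at hlim
  exact le_of_tendsto_of_tendsto' hload hlim fun n => happ n v

/-- The dual formulation has a solution whose first component is the state. -/
theorem IsState.exists_isDualSol (hD : D.Admissible) {ω : Set E3} (h : ω ⊆ D.Ω)
    (hm : MeasurableSet ω) {E : H0curl D.Ω} (hE : D.IsState ω E) :
    ∃ lam, D.IsDualSol ω E lam := by
  obtain ⟨T, c, hc, hT, hTc⟩ := hD.exists_form
  obtain ⟨F, hF⟩ := hD.exists_load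
  -- The residual of the state. Testing the inequality with `E + v`, together with subadditivity of
  -- `phi`, dominates it by `jc ∫_ω |v|`, as required by `exists_multiplier`.
  let Φ : H0curl D.Ω →ₗ[ℝ] ℝ := (toDual F - T E).toLinearMap
  have hΦ : ∀ v, Φ v = D.load v - D.a E v := fun v => by
    rw [hF, hT]
    rfl
  have hfin : volume D.Ω ≠ ∞ := hD.volume_ne_top
  have hle : ∀ v, Φ v ≤ D.jc * ∫ x in ω, ‖fld v x‖ := by
    intro v
    have h1 := hE (E + v)
    rw [add_sub_cancel_left] at h1
    have h2 : D.phi ω (E + v) ≤ D.phi ω E + D.phi ω v := by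
      simp only [phi]
      rw [← mul_add, ← integral_add (integrableOn_norm h hfin _) (integrableOn_norm h hfin _)]
      refine mul_le_mul_of_nonneg_left ?_ hD.jc_pos.le
      refine integral_mono_ae (integrableOn_norm h hfin _)
        ((integrableOn_norm h hfin _).add (integrableOn_norm h hfin _)) ?_
      filter_upwards [ae_restrict_of_subset h (Lp.coeFn_add (fld E) (fld v))] with x hx
      rw [fld_add, hx]
      exact norm_add_le _ _
    rw [hΦ]
    simp only [phi] at h1 h2
    linarith
  obtain ⟨lam, hlam, hcut, hbd⟩ := exists_multiplier h hm hfin hD.jc_pos Φ hle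
  have heqn : ∀ v : H0curl D.Ω, D.a E v + ∫ x in ω, inner ℝ (lam x) (fld v x) = D.load v := by
    intro v
    rw [setIntegral_inner_eq_cut hm h, hcut, ← hlam, hΦ]
    ring
  refine ⟨lam, ?_, heqn, hbd, ?_⟩
  · rw [IsZeroExt, ae_restrict_iff' (hD.domain.isOpen.measurableSet.diff hm)]
    have h1 := coeFn_cut hm lam
    rw [hcut] at h1
    filter_upwards [(ae_restrict_iff' hD.domain.isOpen.measurableSet).1 h1] with x hx hx'
    rw [hx hx'.1, Set.indicator_of_notMem hx'.2]
  · -- testing with `0` gives the reverse of the pointwise inequality in the mean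
    have h1 := hE 0
    have h2 := heqn E
    have h3 : D.phi ω 0 = 0 := by
      simp only [phi]
      rw [integral_eq_zero_of_ae, mul_zero]
      filter_upwards [ae_restrict_of_subset h (Lp.coeFn_zero E3 2 (volume.restrict D.Ω))] with x hx
      have : fld (0 : H0curl D.Ω) = 0 := rfl
      rw [this, hx]
      simp
    have h4 : D.a E (0 - E) = -D.a E E := by rw [hT, hT, zero_sub, map_neg]
    rw [h3, h4, zero_sub, load_neg hD] at h1
    have i1 := (integrableOn_norm h hfin (fld E)).const_mul D.jc
    have i2 := integrableOn_inner h lam (fld E)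
    have hnn : 0 ≤ᵐ[volume.restrict ω]
        fun x => D.jc * ‖fld E x‖ - inner ℝ (lam x) (fld E x) := by
      filter_upwards [hbd] with x hx
      have h5 := real_inner_le_norm (lam x) (fld E x)
      have h6 := mul_le_mul_of_nonneg_right hx (norm_nonneg (fld E x))
      simp only [Pi.zero_apply]
      linarith
    have hz : ∫ x in ω, (D.jc * ‖fld E x‖ - inner ℝ (lam x) (fld E x)) = 0 := by
      refine le_antisymm ?_ (integral_nonneg_of_ae hnn)
      rw [integral_sub i1 i2, integral_const_mul]
      simp only [phi] at h1
      linarith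
    filter_upwards [(integral_eq_zero_iff_of_nonneg_ae hnn (i1.sub i2)).1 hz] with x hx
    simp only [Pi.zero_apply] at hx
    linarith

lemma IsDualSol.isState (hD : D.Admissible) {ω : Set E3} (h : ω ⊆ D.Ω)
    {E : H0curl D.Ω} {lam : L2 D.Ω} (H : D.IsDualSol ω E lam) : D.IsState ω E := by
  have := isApproxState_of_multiplier hD h H.eqn H.bound (d := 0) (by
    filter_upwards [H.align] with x hx
    rw [hx, sub_self])
  rwa [mul_zero, isApproxState_zero] at this

/-- A multiplier extended by zero is determined by its action on the shape. -/
lemma inner_fld_of_isZeroExt (hD : D.Admissible) {ω : Set E3} (h : ω ⊆ D.Ω)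
    (hm : MeasurableSet ω) {lam : L2 D.Ω} (H : D.IsZeroExt ω lam) (v : H0curl D.Ω) :
    ∫ x in ω, inner ℝ (lam x) (fld v x) = toDual lam v := by
  have hcut : cut hm lam = lam := by
    apply Lp.ext
    rw [IsZeroExt, ae_restrict_iff' (hD.domain.isOpen.measurableSet.diff hm)] at H
    have hΩ : ∀ᵐ x ∂volume.restrict D.Ω, x ∈ D.Ω :=
      ae_restrict_mem hD.domain.isOpen.measurableSet
    filter_upwards [coeFn_cut hm lam, ae_restrict_of_ae H, hΩ] with x h1 h2 h3
    rw [h1]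
    by_cases hx : x ∈ ω
    · rw [Set.indicator_of_mem hx]
    · rw [Set.indicator_of_notMem hx, h2 ⟨h3, hx⟩]
  rw [setIntegral_inner_eq_cut hm h, hcut, toDual_apply]

/-- The dual formulation has at most one solution. -/
theorem IsDualSol.unique (hD : D.Admissible) {ω : Set E3} (h : ω ⊆ D.Ω) (hm : MeasurableSet ω)
    {E E' : H0curl D.Ω} {lam lam' : L2 D.Ω} (H : D.IsDualSol ω E lam)
    (H' : D.IsDualSol ω E' lam') : E' = E ∧ lam' = lam := by
  have hE : E' = E := (H'.isState hD h).unique hD h hm (H.isState hD h)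
  refine ⟨hE, ?_⟩
  subst hE
  rw [← sub_eq_zero]
  -- With equal states, the two equations show that the difference of the multipliers annihilates
  -- all fields of `H₀(curl)`.
  refine eq_zero_of_forall_inner_fld hD.domain.isOpen fun v => ?_
  have h1 := H.eqn v
  have h2 := H'.eqn v
  rw [inner_fld_of_isZeroExt hD h hm H.zeroExt] at h1
  rw [inner_fld_of_isZeroExt hD h hm H'.zeroExt] at h2
  rw [inner_sub_left, ← toDual_apply, ← toDual_apply]
  linarith

end Data

/-! ### Continuity of the cost and of the multiplier -/

lemma IsC1.aestronglyMeasurable {F : Type*} [NormedAddCommGroup F] [NormedSpace ℝ F] {B : Set E3}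
    {u : E3 → F} (hu : IsC1 B u) (hB : IsOpen B) :
    AEStronglyMeasurable u (volume.restrict B) :=
  hu.1.continuousOn.aestronglyMeasurable hB.measurableSet

lemma IsC1.memLp_indicator {F : Type*} [NormedAddCommGroup F] [NormedSpace ℝ F]
    {B : Set E3} {u : E3 → F} (hu : IsC1 B u) (hB : IsOpen B) (Ω : Set E3) :
    MemLp (B.indicator u) ∞ (volume.restrict Ω) := by
  obtain ⟨C, hC⟩ := hu.2
  refine memLp_top_of_bound
    ((aestronglyMeasurable_indicator_iff hB.measurableSet).2
      (hu.aestronglyMeasurable hB)).restrict (max C 0) (ae_of_all _ fun x => ?_)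
  by_cases hx : x ∈ B
  · rw [Set.indicator_of_mem hx]
    exact (hC x hx).1.trans (le_max_left _ _)
  · rw [Set.indicator_of_notMem hx, norm_zero]
    exact le_max_right _ _

namespace Data

variable {D : Data}

/-- After extension of `κ` and `Ed` by zero off `B`, the tracking term is a continuous quadratic
form in `fld v - Ed`. The weight is written as a diagonal matrix so that `exists_matrix_mul`
applies. -/
lemma continuous_tracking (hD : D.Admissible) :
    Continuous fun v : H0curl D.Ω => ∫ x in D.B, D.κ x * ‖fld v x - D.Ed x‖ ^ 2 := by
  have hBo := hD.lipB.isOpen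
  have hfin : IsFiniteMeasure (volume.restrict D.Ω : Measure E3) :=
    isFiniteMeasure_restrict.2 hD.volume_ne_top
  have hκ := hD.weight.memLp_indicator hBo D.Ω
  have hEd : MemLp (D.B.indicator D.Ed) 2 (volume.restrict D.Ω) :=
    (hD.target.memLp_indicator hBo D.Ω).mono_exponent le_top
  obtain ⟨A, hA⟩ := exists_matrix_mul (Ω := D.Ω)
    (M := fun x => Matrix.diagonal fun _ => D.B.indicator D.κ x) (fun i j => by
      by_cases hij : i = j
      · subst hij
        simpa using hκ
      · simp [Matrix.diagonal_apply_ne _ hij])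
  have key : ∀ v : H0curl D.Ω, ∫ x in D.B, D.κ x * ‖fld v x - D.Ed x‖ ^ 2 =
      inner ℝ (A (fld v - hEd.toLp _)) (fld v - hEd.toLp _) := by
    intro v
    rw [L2.inner_def, ← Measure.restrict_restrict_of_subset hD.subset,
      ← integral_indicator hBo.measurableSet]
    refine integral_congr_ae ?_
    filter_upwards [hA (fld v - hEd.toLp _), Lp.coeFn_sub (fld v) (hEd.toLp _), hEd.coeFn_toLp]
      with x h1 h2 h3
    have h4 : ∀ (k : ℝ) (ξ : E3),
        Matrix.toEuclideanLin (Matrix.diagonal fun _ : Fin 3 => k) ξ = k • ξ := fun k ξ => by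
      ext i
      simp [Matrix.toEuclideanLin, Matrix.mulVec_diagonal]
    rw [h1, h4, h2, Pi.sub_apply, h3]
    by_cases hx : x ∈ D.B
    · rw [Set.indicator_of_mem hx, Set.indicator_of_mem hx, Set.indicator_of_mem hx,
        real_inner_smul_left, real_inner_self_eq_norm_sq]
    · rw [Set.indicator_of_notMem hx, Set.indicator_of_notMem hx, zero_smul, inner_zero_left]
  simp only [key]
  have hc : Continuous fun v : H0curl D.Ω => fld v - hEd.toLp _ :=
    (fldL D.Ω).continuous.sub continuous_const
  exact (A.continuous.comp hc).inner hc

/-- The volumes differ by at most the measure of the symmetric difference; the tracking term depends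
on the state alone. -/
lemma tendsto_cost (hD : D.Admissible) {ω : ℕ → Set E3} {ω' : Set E3}
    (hω : ∀ n, ω n ⊆ D.Ω) (hω' : ω' ⊆ D.Ω)
    (hconv : Tendsto (fun n => volume (symmDiff (ω n) ω')) atTop (𝓝 0)) {E : ℕ → H0curl D.Ω}
    {E' : H0curl D.Ω} (hE : Tendsto E atTop (𝓝 E')) :
    Tendsto (fun n => D.cost (ω n) (E n)) atTop (𝓝 (D.cost ω' E')) := by
  have hfin : ∀ S ⊆ D.Ω, volume S ≠ ∞ := fun S hS => measure_ne_top_of_subset hS hD.volume_ne_top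
  have hvol : Tendsto (fun n => (volume (ω n)).toReal) atTop (𝓝 (volume ω').toReal) := by
    have h0 := (ENNReal.tendsto_toReal ENNReal.zero_ne_top).comp hconv
    rw [ENNReal.toReal_zero] at h0
    rw [tendsto_iff_norm_sub_tendsto_zero]
    refine squeeze_zero (fun n => norm_nonneg _) (fun n => ?_) h0
    have hs : symmDiff (ω n) ω' ⊆ D.Ω := by
      rintro x (hx | hx)
      exacts [hω n hx.1, hω' hx.1]
    have hle : ∀ S S' : Set E3, S ⊆ D.Ω → S' ⊆ D.Ω →
        (volume S).toReal ≤ (volume S').toReal + (volume (symmDiff S S')).toReal := by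
      intro S S' hS hS'
      have hs : symmDiff S S' ⊆ D.Ω := by
        rintro x (hx | hx)
        exacts [hS hx.1, hS' hx.1]
      rw [← ENNReal.toReal_add (hfin _ hS') (hfin _ hs)]
      refine ENNReal.toReal_mono (ENNReal.add_ne_top.2 ⟨hfin _ hS', hfin _ hs⟩) ?_
      refine (measure_mono fun x hx => ?_).trans (measure_union_le _ _)
      by_cases hx' : x ∈ S'
      · exact Or.inl hx'
      · exact Or.inr (Or.inl ⟨hx, hx'⟩)
    have h1 := hle _ _ (hω n) hω'
    have h2 := hle _ _ hω' (hω n)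
    rw [symmDiff_comm] at h2
    rw [Real.norm_eq_abs]
    exact abs_le.2 ⟨by simp only [Function.comp_apply]; linarith,
      by simp only [Function.comp_apply]; linarith⟩
  simp only [cost, setIntegral_const, Measure.real, smul_eq_mul, mul_one]
  exact ((((continuous_tracking hD).tendsto E').comp hE).const_mul _).add hvol

/-- The multiplier depends continuously on the state, as a functional on `H₀(curl)`. -/
lemma exists_norm_toDual_sub_le (hD : D.Admissible) : ∃ K : ℝ,
    ∀ (E E' : H0curl D.Ω) (lam lam' : L2 D.Ω),
      (∀ v, D.a E v + toDual lam v = D.load v) → (∀ v, D.a E' v + toDual lam' v = D.load v) →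
      ‖toDual lam - toDual lam'‖ ≤ K * ‖E - E'‖ := by
  obtain ⟨T, c, hc, hT, hTc⟩ := hD.exists_form
  obtain ⟨K, hK⟩ := exists_norm_apply_le T
  refine ⟨K, fun E E' lam lam' h h' => ?_⟩
  -- Subtracting the equations cancels the load; the multipliers are compared only as functionals.
  have : toDual lam - toDual lam' = T (E' - E) := by
    ext v
    have h1 := h v
    have h2 := h' v
    rw [hT] at h1 h2
    rw [map_sub]
    simp only [sub_apply]
    linarith
  rw [this, norm_sub_rev E E']
  exact hK _

end Data

end HTS

/-! ### Passage to the limit in the optimization problem -/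

theorem theorem5p3 (D : HTS.Data) (hD : D.Admissible)
    (L : ℝ≥0) (r h : ℝ) (hr : 0 < r) (hh : 0 < h)
    (γ : ℕ → ℝ) (hγ : ∀ n, 0 < γ n) (hγ_lim : Tendsto γ atTop atTop)
    (ω : ℕ → Set HTS.E3)
    (hω : ∀ n, D.IsPenOptimal (γ n) (HTS.Shapes D.B L r h) (ω n))
    (E : ℕ → HTS.H0curl D.Ω) (lam : ℕ → HTS.L2 D.Ω)
    (hE : ∀ n, D.IsPenSol (γ n) (ω n) (E n) (lam n)) :
    ∃ s : ℕ → ℕ, StrictMono s ∧ ∃ ωs : Set HTS.E3,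
      D.IsOptimal (HTS.Shapes D.B L r h) ωs ∧
      HTS.HausdorffConv (fun k => ω (s k)) ωs ∧
      HTS.CharConv (fun k => ω (s k)) ωs ∧
      ∃ (Es : HTS.H0curl D.Ω) (lams : HTS.L2 D.Ω),
        D.IsState ωs Es ∧ D.IsDualSol ωs Es lams ∧
        (∀ E' lam', D.IsDualSol ωs E' lam' → E' = Es ∧ lam' = lams) ∧
        Tendsto (fun k => ‖E (s k) - Es‖) atTop (𝓝 0) ∧
        Tendsto (fun k => ‖HTS.toDual (lam (s k)) - HTS.toDual lams‖) atTop (𝓝 0) := by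
  have hsub : ∀ S ∈ HTS.Shapes D.B L r h, S ⊆ D.Ω := fun S hS => hS.1.trans hD.subset
  have hmeas : ∀ S ∈ HTS.Shapes D.B L r h, MeasurableSet S := fun S hS => hS.2.1.measurableSet
  obtain ⟨s, hs, ωs, hωs, hH⟩ := HTS.exists_subseq_hausdorffConv hD.lipB.isOpen
    hD.lipB.isBounded (fun n => (hω n).1)
  obtain ⟨hchar, hvol⟩ := hH.charConv hr hh hD.lipB.isBounded (fun n => (hω (s n)).1) hωs
  have hγs : Tendsto (fun k => γ (s k)) atTop atTop := hγ_lim.comp hs.tendsto_atTop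
  obtain ⟨Es, hEs⟩ := HTS.Data.exists_state hD (hsub _ hωs) (hmeas _ hωs)
  obtain ⟨lams, hlams⟩ := hEs.exists_isDualSol hD (hsub _ hωs) (hmeas _ hωs)
  -- Stated for arbitrary penalized solutions, because it serves both the given pairs `(E, lam)` and
  -- the pairs contained in the optimality hypothesis, without uniqueness for the penalized problem.
  have hconv : ∀ (E' : ℕ → HTS.H0curl D.Ω) (lam' : ℕ → HTS.L2 D.Ω),
      (∀ k, D.IsPenSol (γ (s k)) (ω (s k)) (E' k) (lam' k)) → Tendsto E' atTop (𝓝 Es) :=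
    fun E' lam' hE' => HTS.Data.tendsto_penSol hD (fun k => hγ (s k)) hγs
      (fun k => hsub _ (hω (s k)).1) (hsub _ hωs) (fun k => hmeas _ (hω (s k)).1) (hmeas _ hωs)
      hvol hE' hEs
  have hEconv := tendsto_iff_norm_sub_tendsto_zero.1 (hconv _ _ fun k => hE (s k))
  refine ⟨s, hs, ωs, ⟨hωs, Es, hEs, fun ω' hω' E' hE' => ?_⟩, hH, hchar, Es, lams, hEs, hlams,
    fun E' lam' H => hlams.unique hD (hsub _ hωs) (hmeas _ hωs) H, hEconv, ?_⟩
  · choose E₁ lam₁ hE₁ hopt using fun k => (hω (s k)).2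
    -- On the fixed competitor `ω'` the penalized states converge to `E'`, so they serve as recovery
    -- sequence in the minimality inequality.
    choose E₂ lam₂ hE₂ using fun k =>
      HTS.Data.exists_penSol hD (hγ (s k)) (hsub _ hω') (hmeas _ hω')
    have hzero : Tendsto (fun _ : ℕ => volume (symmDiff ω' ω')) atTop (𝓝 0) := by simp
    have hlim₁ := HTS.Data.tendsto_cost hD (fun k => hsub _ (hω (s k)).1) (hsub _ hωs) hvol
      (hconv _ _ hE₁)
    have hlim₂ := HTS.Data.tendsto_cost hD (fun _ => hsub _ hω') (hsub _ hω') hzero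
      (HTS.Data.tendsto_penSol hD (fun k => hγ (s k)) hγs (fun _ => hsub _ hω') (hsub _ hω')
        (fun _ => hmeas _ hω') (hmeas _ hω') hzero hE₂ hE')
    exact le_of_tendsto_of_tendsto' hlim₁ hlim₂ fun k => hopt k ω' hω' (E₂ k) (lam₂ k) (hE₂ k)
  · obtain ⟨K, hK⟩ := HTS.Data.exists_norm_toDual_sub_le hD
    have hlim := hEconv.const_mul K
    rw [mul_zero] at hlim
    refine squeeze_zero (fun k => ContinuousLinearMap.opNorm_nonneg _)
      (fun k => hK _ _ _ _ (fun v => ?_) fun v => ?_) hlim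
    · rw [← HTS.Data.inner_fld_of_isZeroExt hD (hsub _ (hω (s k)).1) (hmeas _ (hω (s k)).1)
        (hE (s k)).zeroExt]
      exact (hE (s k)).eqn v
    · rw [← HTS.Data.inner_fld_of_isZeroExt hD (hsub _ hωs) (hmeas _ hωs) hlams.zeroExt]
      exact hlams.eqn v
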